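/- **Skew Cauchy identity.** Let $n,m\ge 1$, let $\mathbf{x}_n=(x_1,\dots,x_n)$ and $\mathbf{y}_m=(y_1,\dots,y_m)$ be indeterminates, and let $\mathbf{a}=(a_k)_{k\in\mathbb{Z}}$, where for some $N\in\mathbb{Z}\sqcup\{\infty\}$ the $a_k$ with $k\le N$ are indeterminates and $a_k=0$ for $k>N$. Everything takes place in the ring of formal power series in these indeterminates over $\mathbb{Z}$ (or any commutative ring), infinite sums being coefficientwise. Partitions are drawn in English convention, and the content of the box $\mathsf{b}$ in row $i$ and column $j$ is $c(\mathsf{b})=j-i$. For partitions $\mu\subseteq\lambda$ the *factorial Schur polynomial* is $$s_{\lambda/\mu}(\mathbf{x}_n|\mathbf{a})=\sum_{T}\ \prod_{\mathsf{b}\in\lambda/\mu}\bigl(x_{T(\mathsf{b})}-a_{T(\mathsf{b})+c(\mathsf{b})}\bigr),$$ the sum being over the semistandard tableaux $T$ of shape $\lambda/\mu$ with entries in $\{1,\dots,n\}$; thus $s_{\lambda/\mu}(\mathbf{x}_n|{-\mathbf{a}})$ has the factors $x_{T(\mathsf{b})}+a_{T(\mathsf{b})+c(\mathsf{b})}$.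 An *edge labeled tableau* of shape $\lambda/\mu$ is a semistandard tableau of shape $\lambda/\mu$ with entries in $\{1,\dots,m\}$, together with a finite subset of $\{1,\dots,m\}$ on every horizontal edge that lies, in its column, between the bottom of $\mu$ and the bottom of $\lambda$ (both included; the columns to the right of $\lambda$ have just their edge on the top boundary of the first row), all but finitely many of these subsets being empty, such that every label on an edge is strictly greater than the entry in the box of $\lambda/\mu$ directly above the edge and strictly smaller than the entry in the box of $\lambda/\mu$ directly below it, whenever there is such a box. Labels on different edges are not compared. The *edge Schur function* is $$E^{\lambda/\mu}(\mathbf{y}_m|\mathbf{a})=\sum_{T}\ \prod_{\mathsf{b}\in\lambda/\mu}y_{T(\mathsf{b})}\ \prod_{e}\ \prod_{\ell\in A_e}y_\ell\,a_{c(e)},$$ the sum being over all edge labeled tableaux $T$ of shape $\lambda/\mu$, where $A_e$ is the set on the edge $e$ and $c(e)$ is the content of the position whose upper edge is $e$. If $\mu\not\subseteq\lambda$, both functions are $0$. For an integer $k\ge 0$ let $\mathbf{a}^{k}=(a^k_i)_{i\in\mathbb{Z}}$ with $a^{k}_i=a_{i+k+1}$. Then for all partitions $\mu$ and $\eta$ $$\sum_{\lambda}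 s_{\lambda/\mu}(\mathbf{x}_n|{-\mathbf{a}})\,E^{\lambda/\eta}(\mathbf{y}_m|\mathbf{a}^{n})=\prod_{\substack{1\le i\le n\\ 1\le j\le m}}\frac{1}{1-x_iy_j}\ \sum_{\kappa}s_{\eta/\kappa}(\mathbf{x}_n|{-\mathbf{a}})\,E^{\mu/\kappa}(\mathbf{y}_m|\mathbf{a}^{0}),$$ where the sums are over all partitions $\lambda$ and $\kappa$, and all the series involved converge. -/

import Mathlib

open scoped MvPowerSeries.WithPiTopology

noncomputable section

namespace SkewCauchy

/-- The boxes of the skew diagram `lam / mu`. As everywhere in Mathlib's `YoungDiagram`,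
a box is a pair (row, column) in English convention, counted from `0`. -/
abbrev SkewBox (lam mu : YoungDiagram) : Type := ↥(lam.cells \ mu.cells)

/-- The content (column minus row) of a position. -/
def content (b : ℕ × ℕ) : ℤ := (b.2 : ℤ) - (b.1 : ℤ)

/-- Semistandard fillings of `lam / mu` with `n` letters: rows weakly increase from left to
right and columns strictly increase from top to bottom. The element `k : Fin n` stands for
the letter `k + 1` of `{1, …, n}`. -/
def IsSemistandard {n : ℕ} {lam mu : YoungDiagram} (T : SkewBox lam mu → Fin n) : Prop :=
  (∀ b c : SkewBox lam mu, b.1.1 = c.1.1 → b.1.2 ≤ c.1.2 → T b ≤ T c) ∧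
  (∀ b c : SkewBox lam mu, b.1.2 = c.1.2 → b.1.1 < c.1.1 → T b < T c)

open Classical in
/-- The skew factorial Schur polynomial `s_{lam/mu}(x_1, …, x_n | a)`: the sum over the
semistandard tableaux `T` of shape `lam / mu` with letters in `{1, …, n}` of the product over
the boxes `b` of `x_{T(b)} - a_{T(b) + c(b)}`, and `0` if `mu` is not contained in `lam`. -/
def factorialSchur {A : Type*} [CommRing A] {n : ℕ} (lam mu : YoungDiagram)
    (x : Fin n → A) (a : ℤ → A) : A :=
  if mu ≤ lam then
    ∑ T : {T : SkewBox lam mu → Fin n // IsSemistandard T},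
      ∏ b : SkewBox lam mu, (x (T.1 b) - a (((T.1 b : ℕ) : ℤ) + 1 + content b.1))
  else 0

/-- A horizontal edge is named by the position whose upper edge it is. The edges of
`lam / mu` that may carry labels are the horizontal edges in each column from the bottom
of `mu` to the bottom of `lam`, both included; row `0` has a top boundary of infinite length,
so a column to the right of `lam` has just its edge on this boundary. -/
def IsLabelEdge (lam mu : YoungDiagram) (e : ℕ × ℕ) : Prop :=
  e ∉ mu ∧ ∀ i < e.1, (i, e.2) ∈ lam

/-- Edge labeled tableaux of shape `lam / mu` with entries and edge labels among `m` letters.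
The finite set `labels` of pairs `(e, l)` records that the letter `l` is in the set that labels
the edge `e`; so every edge has a finite set of labels, and it is empty for almost all edges. -/
structure EdgeTableau (m : ℕ) (lam mu : YoungDiagram) where
  /-- The entries in the boxes. -/
  entry : SkewBox lam mu → Fin m
  /-- The edge labels. -/
  labels : Finset ((ℕ × ℕ) × Fin m)
  semistandard : IsSemistandard entry
  isLabelEdge : ∀ p ∈ labels, IsLabelEdge lam mu p.1
  /-- A label is strictly smaller than the entry in the box below its edge. -/
  label_lt : ∀ p ∈ labels, ∀ b : SkewBox lam mu, b.1 = p.1 → p.2 < entry b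
  /-- A label is strictly greater than the entry in the box above its edge. -/
  lt_label : ∀ p ∈ labels, ∀ b : SkewBox lam mu, (b.1.1 + 1, b.1.2) = p.1 → entry b < p.2

/-- The weight of an edge labeled tableau: a factor `y_k` for every entry `k`, and a factor
`y_l a_{c(b)}` for every label `l` on the upper edge of the position `b`. -/
def EdgeTableau.weight {A : Type*} [CommRing A] {m : ℕ} {lam mu : YoungDiagram}
    (T : EdgeTableau m lam mu) (y : Fin m → A) (a : ℤ → A) : A :=
  (∏ b : SkewBox lam mu, y (T.entry b)) * ∏ p ∈ T.labels, (y p.2 * a (content p.1))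

open Classical in
/-- The edge Schur function `E^{lam/mu}(y_1, …, y_m | a)`, the generating series of the edge
labeled tableaux of shape `lam / mu`, and `0` if `mu` is not contained in `lam`. -/
def edgeSchur {A : Type*} [CommRing A] [TopologicalSpace A] {m : ℕ} (lam mu : YoungDiagram)
    (y : Fin m → A) (a : ℤ → A) : A :=
  if mu ≤ lam then ∑' T : EdgeTableau m lam mu, T.weight y a else 0

/-- The shifted parameters `a^n`, with `(a^n)_i = a_{i+n+1}`. -/
def shift {A : Type*} (n : ℕ) (a : ℤ → A) : ℤ → A := fun i => a (i + n + 1)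

/-- Formal power series in `x_1, …, x_n`, `y_1, …, y_m` and `a_k` for `k` in `ℤ`. With
`MvPowerSeries.WithPiTopology` it has the topology of coefficientwise convergence. -/
abbrev Series (n m : ℕ) (R : Type*) : Type _ := MvPowerSeries (Fin n ⊕ Fin m ⊕ ℤ) R

/-- The indeterminates `x_1, …, x_n`. -/
def varX (n m : ℕ) (R : Type*) [CommRing R] (i : Fin n) : Series n m R :=
  MvPowerSeries.X (Sum.inl i)

/-- The indeterminates `y_1, …, y_m`. -/
def varY (n m : ℕ) (R : Type*) [CommRing R] (j : Fin m) : Series n m R :=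
  MvPowerSeries.X (Sum.inr (Sum.inl j))

open Classical in
/-- The parameters `a`: indeterminates `a_k` for `k ≤ N`, and `a_k = 0` for `k > N`. For
`N = ⊤` all the `a_k` are indeterminates. -/
def paramA (n m : ℕ) (R : Type*) [CommRing R] (N : WithTop ℤ) (k : ℤ) : Series n m R :=
  if (k : WithTop ℤ) ≤ N then MvPowerSeries.X (Sum.inr (Sum.inr k)) else 0

end SkewCauchy

end

/-!
Inserting the letters of a tableau one at a time writes it as a chain of horizontal strips, and so
`s_{lam/mu}` and `E^{lam/mu}` become matrix entries of products of triangular transfer matrices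
`S_i` and `E_j` indexed by partitions, with one factor for each letter. The labels `l` may be
chosen independently on each edge that admits them, which turns them into factors `1 + y_l a_k`.
The identity says that `S Eᵀ = c E'ᵀ S'` with scalars `c`. Such relations can be multiplied, as
soon as infinite matrix products may be reassociated, and this reduces the theorem to one letter
`x` and one letter `y`, where moving `E` past `S` shifts the parameters by one.

For one letter of each kind, `lam / mu` and `lam / eta` are horizontal strips if and only if every
row of `lam` but the first has a length in an interval determined by `mu` and `eta`, and likewise
for `kap` with all its rows. Hence both sums factor over the rows. On the intervals the two sums
are `∑_t ∏_{j < t} P_j ∏_{j ≥ t} Q_{j + 1}` and the same with `P` and `Q` exchanged, where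
`P_j = (x + a_k) y` and `Q_j = 1 + y a_k`. They agree because `Q_j - P_j = 1 - x y` is
independent of `j`. The unbounded first row of `lam` gives a telescoping series, whose sum is the
factor `1 / (1 - x y)`.
-/

noncomputable section

namespace SkewCauchy

section Series

open MvPowerSeries

variable {σ R ι κ : Type*} [CommRing R]

/-- A family of power series of which only finitely many members contribute to the coefficient
at any given monomial. Such a family is summable whatever the topology of the coefficient
ring, and its sum is the coefficientwise one. -/
def CoeffFinite (f : ι → MvPowerSeries σ R) : Prop :=
  ∀ d, {i | coeff d (f i) ≠ 0}.Finite

theorem exists_coeff_ne_zero_of_mul {f g : MvPowerSeries σ R} {d : σ →₀ ℕ}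
    (h : coeff d (f * g) ≠ 0) : ∃ p ≤ d, ∃ q ≤ d, coeff p f ≠ 0 ∧ coeff q g ≠ 0 := by
  classical
  rw [coeff_mul] at h
  obtain ⟨p, hp, hne⟩ := Finset.exists_ne_zero_of_sum_ne_zero h
  rw [← Finset.HasAntidiagonal.mem_antidiagonal.1 hp]
  exact ⟨p.1, le_self_add, p.2, le_add_self, left_ne_zero_of_mul hne, right_ne_zero_of_mul hne⟩

namespace CoeffFinite

variable {f : ι → MvPowerSeries σ R}

theorem finite_exists_le (hf : CoeffFinite f) (d : σ →₀ ℕ) :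
    {i | ∃ e ≤ d, coeff e (f i) ≠ 0}.Finite := by
  classical
  refine ((Set.finite_Iic d).biUnion fun e _ => hf e).subset ?_
  rintro i ⟨e, he, hi⟩
  exact Set.mem_biUnion (Set.mem_Iic.2 he) hi

theorem summable [TopologicalSpace R] (hf : CoeffFinite f) : Summable f := by
  rw [WithPiTopology.summable_iff_summable_coeff]
  exact fun d => summable_of_hasFiniteSupport (hf d)

theorem comp_injective (hf : CoeffFinite f) {g : κ → ι} (hg : Function.Injective g) :
    CoeffFinite (fun k => f (g k)) :=
  fun d => (hf d).preimage hg.injOn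

theorem tsum_sigma {κ : ι → Type*} {f : (Σ i, κ i) → MvPowerSeries σ R} [TopologicalSpace R]
    [IsTopologicalRing R] [T2Space R] (hf : CoeffFinite f) :
    ∑' q, f q = ∑' i, ∑' j, f ⟨i, j⟩ :=
  hf.summable.tsum_sigma' fun _ => (hf.comp_injective sigma_mk_injective).summable

theorem mul_left (hf : CoeffFinite f) (g : ι → MvPowerSeries σ R) :
    CoeffFinite (fun i => g i * f i) := by
  refine fun d => (hf.finite_exists_le d).subset fun i hi => ?_
  obtain ⟨-, -, q, hq, -, hfq⟩ := exists_coeff_ne_zero_of_mul hi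
  exact ⟨q, hq, hfq⟩

theorem prod_mul (hf : CoeffFinite f) {g : ι → κ → MvPowerSeries σ R}
    (hg : ∀ i, CoeffFinite (g i)) : CoeffFinite (fun p : ι × κ => f p.1 * g p.1 p.2) := by
  classical
  intro d
  refine ((hf.finite_exists_le d).biUnion fun i _ =>
    ((hg i).finite_exists_le d).image (Prod.mk i)).subset ?_
  rintro ⟨i, k⟩ h
  obtain ⟨p, hp, q, hq, hfp, hgq⟩ := exists_coeff_ne_zero_of_mul h
  exact Set.mem_biUnion (show i ∈ _ from ⟨p, hp, hfp⟩) ⟨k, ⟨q, hq, hgq⟩, rfl⟩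

theorem finset_prod (hf : CoeffFinite f) :
    CoeffFinite (fun s : Finset ι => ∏ i ∈ s, f i) := by
  classical
  intro d
  have hfin := hf.finite_exists_le d
  refine (Finset.finite_toSet hfin.toFinset.powerset).subset fun s hs => ?_
  refine Finset.mem_coe.2 (Finset.mem_powerset.2 fun i hi => hfin.mem_toFinset.2 ?_)
  have hs : coeff d ((∏ j ∈ s.erase i, f j) * f i) ≠ 0 := by
    rwa [Finset.prod_erase_mul _ _ hi]
  obtain ⟨-, -, q, hq, -, hfq⟩ := exists_coeff_ne_zero_of_mul hs
  exact ⟨q, hq, hfq⟩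

theorem of_order {N : ι → ℕ} (hN : ∀ k, {i | N i ≤ k}.Finite)
    (hf : ∀ i, (N i : ℕ∞) ≤ (f i).order) : CoeffFinite f :=
  fun d => (hN d.degree).subset fun i hi => by exact_mod_cast (hf i).trans (order_le hi)

theorem multipliable_one_add [TopologicalSpace R] (hf : CoeffFinite f) :
    Multipliable (fun i => 1 + f i) :=
  multipliable_one_add_of_summable_prod hf.finset_prod.summable

end CoeffFinite

end Series

section Triangular

variable {α A : Type*} [PartialOrder α] [LocallyFiniteOrder α] [CommRing A]

theorem hasSum_mul_apply [TopologicalSpace A] (U V : IncidenceAlgebra A α) (a b : α) :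
    HasSum (fun s => U a s * V s b) ((U * V) a b) := by
  rw [IncidenceAlgebra.mul_apply]
  refine hasSum_sum_of_ne_finset_zero fun s hs => ?_
  by_cases has : a ≤ s
  · rw [V.apply_eq_zero_of_not_le fun hsb => hs (Finset.mem_Icc.2 ⟨has, hsb⟩), mul_zero]
  · rw [U.apply_eq_zero_of_not_le has, zero_mul]

variable [OrderBot α]

theorem sum_Iic_mul_comm (U V : IncidenceAlgebra A α) (a b : α) :
    ∑ q ∈ Finset.Iic b, U q b * V q a = ∑ q ∈ Finset.Iic a, V q a * U q b := by
  classical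
  have hU : ∑ q ∈ Finset.Iic b, U q b * V q a = ∑ q ∈ Finset.Iic b ∩ Finset.Iic a, U q b * V q a :=
    (Finset.sum_subset Finset.inter_subset_left fun q hb hq => by
      rw [V.apply_eq_zero_of_not_le fun h => hq (Finset.mem_inter.2 ⟨hb, Finset.mem_Iic.2 h⟩),
        mul_zero]).symm
  rw [hU]
  refine (Finset.sum_subset Finset.inter_subset_right fun q ha hq => ?_).trans
    (Finset.sum_congr rfl fun q _ => mul_comm _ _)
  rw [U.apply_eq_zero_of_not_le fun h => hq (Finset.mem_inter.2 ⟨Finset.mem_Iic.2 h, ha⟩),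
    zero_mul]

theorem sum_Iic_mul_mul (U V W : IncidenceAlgebra A α) (a b : α) :
    ∑ q ∈ Finset.Iic b, V q b * ∑ r ∈ Finset.Iic q, U r q * W r a =
      ∑ r ∈ Finset.Iic b, (U * V) r b * W r a := by
  simp only [IncidenceAlgebra.mul_apply, Finset.mul_sum, Finset.sum_mul]
  rw [Finset.sum_comm' (t' := Finset.Iic b) (s' := fun r => Finset.Icc r b) fun q r => by
    simp only [Finset.mem_Iic, Finset.mem_Icc]
    exact ⟨fun h => ⟨⟨h.2, h.1⟩, h.2.trans h.1⟩, fun h => ⟨h.1.2, h.1.1⟩⟩]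
  exact Finset.sum_congr rfl fun r _ => Finset.sum_congr rfl fun q _ => by ring

end Triangular

section Intertwining

variable {α A : Type*} [PartialOrder α] [LocallyFiniteOrder α] [OrderBot α] [CommRing A]
  [TopologicalSpace A]

/-- The relation `U Vᵀ = c V'ᵀ U'` between triangular matrices, where `ᵀ` is the transpose.
An entry of the left hand side is an infinite sum, which is required to converge; on the right
the sum is finite, since `U' q b = 0` unless `q ≤ b`. -/
def Intertwine (U V U' V' : IncidenceAlgebra A α) (c : A) : Prop :=
  ∀ a b, HasSum (fun p => U a p * V b p) (c * ∑ q ∈ Finset.Iic b, U' q b * V' q a)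

variable {U V U' V' : IncidenceAlgebra A α} {c : A}

theorem Intertwine.symm (h : Intertwine U V U' V' c) : Intertwine V U V' U' c := by
  intro a b
  rw [sum_Iic_mul_comm]
  simpa only [mul_comm (V a _)] using h b a

theorem intertwine_one_left [DecidableEq α] (V : IncidenceAlgebra A α) :
    Intertwine 1 V 1 V 1 := by
  intro a b
  have hright : ∑ q ∈ Finset.Iic b, (1 : IncidenceAlgebra A α) q b * V q a = V b a := by
    simp [IncidenceAlgebra.one_apply]
  rw [hright, one_mul]
  convert hasSum_single a fun p hp => ?_ using 1
  · simp [IncidenceAlgebra.one_apply]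
  · simp [IncidenceAlgebra.one_apply, hp.symm]

/-- `(U₁ U₂) Vᵀ = c₂ U₁ V'ᵀ U₂' = c₁ c₂ V''ᵀ (U₁' U₂')`; the summability hypothesis is what allows
one to reassociate the triple product of infinite matrices. -/
theorem Intertwine.mul [IsTopologicalRing A] [T2Space A]
    {U₁ U₂ U₁' U₂' V'' : IncidenceAlgebra A α} {c₁ c₂ : A}
    (h₁ : Intertwine U₁ V' U₁' V'' c₁) (h₂ : Intertwine U₂ V U₂' V' c₂)
    (hs : ∀ a b, Summable fun p : α × α => U₁ a p.1 * U₂ p.1 p.2 * V b p.2) :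
    Intertwine (U₁ * U₂) V (U₁' * U₂') V'' (c₁ * c₂) := by
  intro a b
  obtain ⟨S, hS⟩ := hs a b
  have hrows : HasSum (fun s => U₁ a s * (c₂ * ∑ q ∈ Finset.Iic b, U₂' q b * V' q s)) S :=
    hS.prod_fiberwise fun s => by simpa only [mul_assoc] using (h₂ s b).mul_left (U₁ a s)
  have hcols : HasSum (fun p => (U₁ * U₂) a p * V b p) S :=
    ((Equiv.prodComm α α).hasSum_iff.2 hS).prod_fiberwise fun p =>
      (hasSum_mul_apply U₁ U₂ a p).mul_right (V b p)
  have hvalue : HasSum (fun s => U₁ a s * (c₂ * ∑ q ∈ Finset.Iic b, U₂' q b * V' q s))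
      (c₂ * ∑ q ∈ Finset.Iic b, U₂' q b * (c₁ * ∑ r ∈ Finset.Iic q, U₁' r q * V'' r a)) := by
    refine HasSum.congr_fun
      ((hasSum_sum fun q _ => (h₁ a q).mul_left (U₂' q b)).mul_left c₂) fun s => ?_
    rw [mul_left_comm, Finset.mul_sum]
    exact congrArg _ (Finset.sum_congr rfl fun q _ => mul_left_comm _ _ _)
  rw [hrows.unique hvalue] at hcols
  convert hcols using 1
  simp only [← sum_Iic_mul_mul, Finset.mul_sum]
  exact Finset.sum_congr rfl fun q _ => Finset.sum_congr rfl fun r _ => by ring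

end Intertwining

section RowFinite

variable {α σ R : Type*} [PartialOrder α] [CommRing R]

/-- Every row of the triangular matrix `U` is a coefficientwise summable family. Products of
row finite matrices with each other may therefore be summed in any order. -/
def RowFinite (U : IncidenceAlgebra (MvPowerSeries σ R) α) : Prop :=
  ∀ a, CoeffFinite (U a)

variable {U V : IncidenceAlgebra (MvPowerSeries σ R) α}

theorem rowFinite_one [DecidableEq α] :
    RowFinite (1 : IncidenceAlgebra (MvPowerSeries σ R) α) := by
  refine fun a d => (Set.finite_singleton a).subset fun b hb => ?_
  by_contra hne
  exact hb (by rw [IncidenceAlgebra.one_apply, if_neg (Ne.symm hne), map_zero])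

variable [LocallyFiniteOrder α]

theorem RowFinite.mul (hU : RowFinite U) (hV : RowFinite V) : RowFinite (U * V) := by
  refine fun a d => (((hU a).prod_mul hV d).image Prod.snd).subset fun b hb => ?_
  have hb' : ∑ s ∈ Finset.Icc a b, MvPowerSeries.coeff d (U a s * V s b) ≠ 0 := by
    simpa only [Set.mem_ofPred_eq, IncidenceAlgebra.mul_apply, map_sum] using hb
  obtain ⟨s, -, hs⟩ := Finset.exists_ne_zero_of_sum_ne_zero hb'
  exact ⟨(s, b), hs, rfl⟩

theorem rowFinite_list_prod [DecidableEq α] {L : List (IncidenceAlgebra (MvPowerSeries σ R) α)}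
    (hL : ∀ U ∈ L, RowFinite U) : RowFinite L.prod :=
  L.prod_induction RowFinite (fun _ _ => RowFinite.mul) rowFinite_one hL

variable [OrderBot α]

theorem coeffFinite_mul_mul (U₁ U₂ : IncidenceAlgebra (MvPowerSeries σ R) α) (hV : RowFinite V)
    (a b : α) : CoeffFinite fun p : α × α => U₁ a p.1 * U₂ p.1 p.2 * V b p.2 := by
  intro d
  refine (((hV b).finite_exists_le d).biUnion fun p _ =>
    (Set.finite_Iic p).image fun s => (s, p)).subset ?_
  rintro ⟨s, p⟩ h
  obtain ⟨e, -, q, hq, hUe, hVq⟩ := exists_coeff_ne_zero_of_mul h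
  have hsp : s ≤ p := by
    by_contra hsp
    rw [U₂.apply_eq_zero_of_not_le hsp, mul_zero, map_zero] at hUe
    exact hUe rfl
  exact Set.mem_biUnion (show p ∈ _ from ⟨q, hq, hVq⟩) ⟨s, hsp, rfl⟩

variable [DecidableEq α] [TopologicalSpace R] [IsTopologicalRing R] [T2Space R]

theorem Intertwine.list_prod {n : ℕ} {U U' : Fin n → IncidenceAlgebra (MvPowerSeries σ R) α}
    {V : ℕ → IncidenceAlgebra (MvPowerSeries σ R) α} {c : Fin n → MvPowerSeries σ R}
    (hfin : (∀ i, RowFinite (U i)) ∨ ∀ i, RowFinite (V i))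
    (h : ∀ i : Fin n, Intertwine (U i) (V (i + 1)) (U' i) (V i) (c i)) :
    Intertwine (List.ofFn U).prod (V n) (List.ofFn U').prod (V 0) (∏ i, c i) := by
  induction n generalizing V with
  | zero => simpa using intertwine_one_left (V 0)
  | succ n ih =>
    rw [List.ofFn_succ, List.ofFn_succ, List.prod_cons, List.prod_cons, Fin.prod_univ_succ]
    refine (h 0).mul (ih (V := fun i => V (i + 1))
      (hfin.imp (fun hU i => hU i.succ) fun hV i => hV (i + 1)) fun i => h i.succ)
      fun a b => ?_
    rcases hfin with hU | hV
    · have htail : RowFinite (List.ofFn fun i : Fin n => U i.succ).prod :=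
        rowFinite_list_prod (List.forall_mem_ofFn_iff.2 fun i => hU i.succ)
      refine (((hU 0 a).prod_mul htail).mul_left fun p => V (n + 1) b p.2).summable.congr ?_
      exact fun p => mul_comm _ _
    · exact (coeffFinite_mul_mul _ _ (hV _) a b).summable

end RowFinite

section Diagrams

theorem cells_injective : Function.Injective YoungDiagram.cells :=
  fun _ _ => YoungDiagram.ext

theorem finite_setOf_le (lam : YoungDiagram) : {nu : YoungDiagram | nu ≤ lam}.Finite :=
  ((Finset.finite_toSet lam.cells.powerset).preimage cells_injective.injOn).subset fun _ h =>
    Finset.mem_coe.2 (Finset.mem_powerset.2 (YoungDiagram.cells_subset_iff.2 h))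

instance : LocallyFiniteOrder YoungDiagram :=
  LocallyFiniteOrder.ofFiniteIcc fun _ lam => (finite_setOf_le lam).subset Set.Icc_subset_Iic_self

instance : DecidableEq YoungDiagram := Classical.decEq _

theorem mem_range_card_of_mem {lam : YoungDiagram} {b : ℕ × ℕ} (hb : b ∈ lam) :
    b ∈ Finset.range lam.card ×ˢ Finset.range lam.card := by
  rw [Finset.mem_product, Finset.mem_range, Finset.mem_range]
  constructor
  · exact (YoungDiagram.mem_iff_lt_colLen.1 hb).trans_le
      (lam.colLen_eq_card.trans_le (Finset.card_le_card (Finset.filter_subset _ _)))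
  · exact (YoungDiagram.mem_iff_lt_rowLen.1 hb).trans_le
      (lam.rowLen_eq_card.trans_le (Finset.card_le_card (Finset.filter_subset _ _)))

theorem finite_setOf_card_le (k : ℕ) : {lam : YoungDiagram | lam.card ≤ k}.Finite := by
  refine ((Finset.finite_toSet (Finset.range k ×ˢ Finset.range k).powerset).preimage
    cells_injective.injOn).subset fun lam hlam => ?_
  refine Finset.mem_coe.2 (Finset.mem_powerset.2 fun b hb => ?_)
  have hk := Finset.range_subset_range.2 hlam
  exact Finset.product_subset_product hk hk (mem_range_card_of_mem hb)

theorem le_iff_rowLen {mu lam : YoungDiagram} :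
    mu ≤ lam ↔ ∀ i, mu.rowLen i ≤ lam.rowLen i := by
  simp only [← SetLike.coe_subset_coe, Set.subset_def, SetLike.mem_coe, Prod.forall,
    YoungDiagram.mem_iff_lt_rowLen]
  exact forall_congr' fun i => forall_lt_iff_le

theorem rowLen_injective : Function.Injective YoungDiagram.rowLen := fun _ _ h =>
  le_antisymm (le_iff_rowLen.2 fun i => (congrFun h i).le)
    (le_iff_rowLen.2 fun i => (congrFun h i).ge)

theorem exists_rowLen_eq {f : ℕ → ℕ} (hf : Antitone f) {r : ℕ} (hr : f r = 0) :
    ∃ lam : YoungDiagram, lam.rowLen = f := by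
  refine ⟨YoungDiagram.ofRowLens (List.ofFn fun i : Fin r => f i)
    (List.sortedGE_ofFn_iff.2 fun i j hij => hf hij), funext fun i => ?_⟩
  refine eq_of_forall_lt_iff fun j => ?_
  rw [← YoungDiagram.mem_iff_lt_rowLen, YoungDiagram.mem_ofRowLens]
  simp only [List.length_ofFn, List.getElem_ofFn, exists_prop, and_iff_right_iff_imp]
  intro hj
  by_contra! hri
  exact absurd (hj.trans_le (hf hri)) (by omega)

theorem exists_rowLen_eq_zero (lam : YoungDiagram) : ∃ r, lam.rowLen r = 0 := by
  obtain ⟨r, hr⟩ := lam.exists_notMem_col 0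
  refine ⟨r, Nat.eq_zero_of_not_pos fun hpos => hr ?_⟩
  exact YoungDiagram.mem_iff_lt_rowLen.2 hpos

theorem rowLen_eq_zero_of_le {lam : YoungDiagram} {r i : ℕ} (hr : lam.rowLen r = 0) (hi : r ≤ i) :
    lam.rowLen i = 0 :=
  Nat.le_zero.1 ((lam.rowLen_anti r i hi).trans hr.le)

end Diagrams

section HorizontalStrips

/-- The skew diagram `lam / mu` is a horizontal strip: `mu` is contained in `lam`, and `lam / mu`
has at most one box in every column. -/
def HStrip (mu lam : YoungDiagram) : Prop :=
  mu ≤ lam ∧ ∀ i j, (i + 1, j) ∈ lam → (i, j) ∈ mu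

theorem hStrip_iff_rowLen {mu lam : YoungDiagram} :
    HStrip mu lam ↔ ∀ i, mu.rowLen i ≤ lam.rowLen i ∧ lam.rowLen (i + 1) ≤ mu.rowLen i := by
  simp only [HStrip, le_iff_rowLen, forall_and, YoungDiagram.mem_iff_lt_rowLen, forall_lt_iff_le]

theorem prod_sdiff_cells {A : Type*} [CommMonoid A] {mu lam : YoungDiagram} {r : ℕ}
    (hr : lam.rowLen r = 0) (f : ℕ × ℕ → A) :
    ∏ b ∈ lam.cells \ mu.cells, f b
      = ∏ i ∈ Finset.range r, ∏ j ∈ Finset.Ico (mu.rowLen i) (lam.rowLen i), f (i, j) := by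
  have hcells : lam.cells \ mu.cells = ((Finset.range r).sigma fun i =>
      Finset.Ico (mu.rowLen i) (lam.rowLen i)).map (Equiv.sigmaEquivProd ℕ ℕ).toEmbedding := by
    ext ⟨i, j⟩
    simp only [Finset.mem_sdiff, YoungDiagram.mem_cells, YoungDiagram.mem_iff_lt_rowLen,
      Finset.mem_map_equiv, Equiv.sigmaEquivProd_symm_apply, Finset.mem_sigma, Finset.mem_range,
      Finset.mem_Ico]
    have hi : r ≤ i → lam.rowLen i = 0 := rowLen_eq_zero_of_le hr
    omega
  rw [hcells, Finset.prod_map, Finset.prod_sigma]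
  rfl

end HorizontalStrips

section Steps

variable {A : Type*} [CommRing A]

open Classical in
/-- The transfer matrix of one letter `x` of a factorial Schur polynomial with parameters `-a`:
the boxes with this letter form a horizontal strip. -/
def schurStep (x : A) (a : ℤ → A) : IncidenceAlgebra A YoungDiagram where
  toFun mu lam :=
    if HStrip mu lam then ∏ b ∈ lam.cells \ mu.cells, (x + a (content b)) else 0
  eq_zero_of_not_le' _ _ h := if_neg fun h' => h h'.1

open Classical in
/-- The transfer matrix of one letter `y` of an edge Schur function. If the boxes with this letter
are those of the horizontal strip `lam / mu`, the letter may label the edges which are below a box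
of `mu` or on the top boundary, and above a position outside `lam`. -/
def edgeStep [TopologicalSpace A] (y : A) (a : ℤ → A) : IncidenceAlgebra A YoungDiagram where
  toFun mu lam :=
    if HStrip mu lam then
      y ^ (lam.cells \ mu.cells).card *
        ∏' e : {e : ℕ × ℕ | IsLabelEdge mu lam e}, (1 + y * a (content e))
    else 0
  eq_zero_of_not_le' _ _ h := if_neg fun h' => h h'.1

theorem schurStep_apply {mu lam : YoungDiagram} (h : HStrip mu lam) (x : A) (a : ℤ → A) :
    schurStep x a mu lam = ∏ b ∈ lam.cells \ mu.cells, (x + a (content b)) :=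
  if_pos h

theorem schurStep_eq_zero {mu lam : YoungDiagram} (h : ¬HStrip mu lam) (x : A) (a : ℤ → A) :
    schurStep x a mu lam = 0 :=
  if_neg h

variable [TopologicalSpace A]

theorem edgeStep_apply {mu lam : YoungDiagram} (h : HStrip mu lam) (y : A) (a : ℤ → A) :
    edgeStep y a mu lam = y ^ (lam.cells \ mu.cells).card *
      ∏' e : {e : ℕ × ℕ | IsLabelEdge mu lam e}, (1 + y * a (content e)) :=
  if_pos h

theorem edgeStep_eq_zero {mu lam : YoungDiagram} (h : ¬HStrip mu lam) (y : A) (a : ℤ → A) :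
    edgeStep y a mu lam = 0 :=
  if_neg h

theorem rowFinite_edgeStep {σ R : Type*} [CommRing R] [TopologicalSpace R] {y : MvPowerSeries σ R}
    (hy : y.constantCoeff = 0) (a : ℤ → MvPowerSeries σ R) : RowFinite (edgeStep y a) := by
  refine fun mu => CoeffFinite.of_order (N := fun lam => (lam.cells \ mu.cells).card)
    (fun k => (finite_setOf_card_le (k + mu.card)).subset fun lam hlam => ?_) fun lam => ?_
  · exact Finset.card_le_card_sdiff_add_card.trans (Nat.add_le_add_right hlam _)
  · by_cases h : HStrip mu lam
    · rw [edgeStep_apply h]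
      exact (MvPowerSeries.le_order_pow_of_constantCoeff_eq_zero _ hy).trans
        (le_self_add.trans MvPowerSeries.le_order_mul)
    · rw [edgeStep_eq_zero h, MvPowerSeries.order_zero]
      exact le_top

/-- The product of the factors `1 + y a_k` over all `k ≥ t`: the generating series of the labels
on the top boundary to the right of column `t`. -/
def edgeTail (y : A) (a : ℤ → A) (t : ℤ) : A :=
  ∏' j : ℕ, (1 + y * a (t + j))

theorem edgeTail_shift (y : A) (a : ℤ → A) (t : ℤ) :
    edgeTail y (fun k => a (k + 1)) t = edgeTail y a (t + 1) := by
  simp only [edgeTail, add_right_comm t 1]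

end Steps

section EdgeTail

variable {σ R : Type*} [CommRing R] [TopologicalSpace R] {a : ℤ → MvPowerSeries σ R}

theorem multipliable_edgeTail (ha : CoeffFinite a) (y : MvPowerSeries σ R) (t : ℤ) :
    Multipliable (fun j : ℕ => 1 + y * a (t + j)) :=
  ((ha.mul_left fun _ => y).comp_injective
    ((add_right_injective t).comp Nat.cast_injective)).multipliable_one_add

variable [IsTopologicalRing R] [T2Space R]

theorem edgeTail_eq_mul (ha : CoeffFinite a) (y : MvPowerSeries σ R) (t : ℤ) :
    edgeTail y a t = (1 + y * a t) * edgeTail y a (t + 1) := by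
  have hshift (j : ℕ) : 1 + y * a (t + 1 + j) = 1 + y * a (t + (j + 1 : ℕ)) := by
    rw [Nat.cast_succ, add_assoc, add_comm (1 : ℤ)]
  have hmul := multipliable_edgeTail ha y (t + 1)
  simp only [edgeTail, hshift] at hmul ⊢
  simpa only [Nat.cast_zero, add_zero] using
    tprod_eq_zero_mul' (f := fun j : ℕ => 1 + y * a (t + j)) hmul

theorem edgeTail_eq_prod_Ico_mul (ha : CoeffFinite a) (y : MvPowerSeries σ R) {s t : ℕ}
    (h : s ≤ t) :
    edgeTail y a s = (∏ j ∈ Finset.Ico s t, (1 + y * a j)) * edgeTail y a t := by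
  induction t, h using Nat.le_induction with
  | base => rw [Finset.Ico_self, Finset.prod_empty, one_mul]
  | succ t hst ih =>
    rw [ih, Finset.prod_Ico_succ_top hst, edgeTail_eq_mul ha y t, Nat.cast_succ, mul_assoc]

end EdgeTail

section LabelEdges

variable {mu lam : YoungDiagram}

theorem isLabelEdge_zero {j : ℕ} : IsLabelEdge mu lam (0, j) ↔ lam.rowLen 0 ≤ j := by
  simp [IsLabelEdge, YoungDiagram.mem_iff_lt_rowLen]

theorem isLabelEdge_succ {i j : ℕ} :
    IsLabelEdge mu lam (i + 1, j) ↔ lam.rowLen (i + 1) ≤ j ∧ j < mu.rowLen i := by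
  simp only [IsLabelEdge, YoungDiagram.mem_iff_lt_rowLen, not_lt]
  refine and_congr_right fun _ => ⟨fun h => h i (Nat.lt_succ_self i), fun h k hk => ?_⟩
  exact h.trans_le (mu.rowLen_anti _ _ (Nat.lt_succ_iff.1 hk))

/-- The edges below the first row that may be labeled, when all the rows of `mu` from row `r` on
are empty. -/
def lowerLabelEdges (mu lam : YoungDiagram) (r : ℕ) : Finset (ℕ × ℕ) :=
  ((Finset.range r).sigma fun i => Finset.Ico (lam.rowLen (i + 1)) (mu.rowLen i)).image
    fun p => (p.1 + 1, p.2)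

theorem prod_lowerLabelEdges {A : Type*} [CommMonoid A] (r : ℕ) (f : ℕ × ℕ → A) :
    ∏ e ∈ lowerLabelEdges mu lam r, f e = ∏ i ∈ Finset.range r,
      ∏ j ∈ Finset.Ico (lam.rowLen (i + 1)) (mu.rowLen i), f (i + 1, j) := by
  rw [lowerLabelEdges, Finset.prod_image, Finset.prod_sigma]
  rintro ⟨i, j⟩ - ⟨i', j'⟩ - h
  simpa using h

theorem mem_lowerLabelEdges {r : ℕ} (hr : mu.rowLen r = 0) {e : ℕ × ℕ} :
    e ∈ lowerLabelEdges mu lam r ↔ e.1 ≠ 0 ∧ IsLabelEdge mu lam e := by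
  obtain ⟨_ | i, j⟩ := e
  · simp [lowerLabelEdges]
  · have hi : r ≤ i → mu.rowLen i = 0 := rowLen_eq_zero_of_le hr
    simp only [lowerLabelEdges, isLabelEdge_succ, Finset.mem_image, Finset.mem_sigma,
      Finset.mem_range, Finset.mem_Ico, Sigma.exists, Prod.mk.injEq, Nat.add_right_cancel_iff,
      exists_eq_right_right, exists_eq_right]
    omega

theorem setOf_isLabelEdge_eq {r : ℕ} (hr : mu.rowLen r = 0) :
    {e | IsLabelEdge mu lam e} =
      Set.range (fun k : ℕ => (0, lam.rowLen 0 + k)) ∪ ↑(lowerLabelEdges mu lam r) := by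
  ext ⟨i, j⟩
  rw [Set.mem_union, Finset.mem_coe, mem_lowerLabelEdges hr, Set.mem_ofPred_eq, Set.mem_range]
  rcases i with _ | i
  · simp [isLabelEdge_zero, le_iff_exists_add, eq_comm]
  · simp

theorem tprod_isLabelEdge {σ R : Type*} [CommRing R] [TopologicalSpace R] [IsTopologicalRing R]
    [T2Space R] {a : ℤ → MvPowerSeries σ R} (ha : CoeffFinite a) (y : MvPowerSeries σ R) {r : ℕ}
    (hr : mu.rowLen r = 0) :
    ∏' e : {e : ℕ × ℕ | IsLabelEdge mu lam e}, (1 + y * a (content e))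
      = edgeTail y a (lam.rowLen 0) * ∏ i ∈ Finset.range r,
          ∏ j ∈ Finset.Ico (lam.rowLen (i + 1)) (mu.rowLen i), (1 + y * a ((j : ℤ) - (i + 1))) := by
  have htop : HasProd (fun e : Set.range fun k : ℕ => (0, lam.rowLen 0 + k) =>
      1 + y * a (content e)) (edgeTail y a (lam.rowLen 0)) := by
    refine (Function.Injective.hasProd_range_iff (f := fun e => 1 + y * a (content e))
      ((Prod.mk_right_injective 0).comp (add_right_injective _))).2 ?_
    refine (multipliable_edgeTail ha y _).hasProd.congr_fun fun k => ?_
    simp [content]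
  have hlower : HasProd (fun e : (lowerLabelEdges mu lam r : Set (ℕ × ℕ)) =>
      1 + y * a (content e)) (∏ e ∈ lowerLabelEdges mu lam r, (1 + y * a (content e))) :=
    (lowerLabelEdges mu lam r).hasProd fun e => 1 + y * a (content e)
  have hdisj : Disjoint (Set.range fun k : ℕ => (0, lam.rowLen 0 + k))
      (lowerLabelEdges mu lam r : Set (ℕ × ℕ)) := by
    rw [Set.disjoint_left]
    rintro _ ⟨k, rfl⟩ h
    exact ((mem_lowerLabelEdges hr).1 h).1 rfl
  have hall := HasProd.mul_disjoint (f := fun e => 1 + y * a (content e)) hdisj htop hlower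
  rw [← setOf_isLabelEdge_eq hr, prod_lowerLabelEdges] at hall
  simpa [content] using hall.tprod_eq

end LabelEdges

section Intervals

theorem prod_Ico_of_max_le {A : Type*} [CommMonoid A] (f : ℕ → A) {p q s : ℕ} (h : max p q ≤ s) :
    ∏ j ∈ Finset.Ico p s, f j
      = (∏ j ∈ Finset.Ico p q, f j) * ∏ j ∈ Finset.Ico (max p q) s, f j := by
  rcases le_total p q with hpq | hpq
  · rw [max_eq_right hpq] at *
    rw [Finset.prod_Ico_consecutive _ hpq h]
  · rw [max_eq_left hpq, Finset.Ico_eq_empty_of_le hpq, Finset.prod_empty, one_mul]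

theorem prod_Ico_of_le_min {A : Type*} [CommMonoid A] (f : ℕ → A) {p q s : ℕ} (h : s ≤ min p q) :
    ∏ j ∈ Finset.Ico s q, f j
      = (∏ j ∈ Finset.Ico p q, f j) * ∏ j ∈ Finset.Ico s (min p q), f j := by
  rcases le_total p q with hpq | hpq
  · rw [min_eq_left hpq] at *
    rw [mul_comm, Finset.prod_Ico_consecutive _ h hpq]
  · rw [min_eq_right hpq, Finset.Ico_eq_empty_of_le hpq, Finset.prod_empty, one_mul]

variable {A : Type*} [CommRing A]

/-- The sum over the ways to cut the interval from `lo` to `hi` at some `t`, with a factor `P j`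
for every step before the cut and a factor `Q (j + 1)` for every step after it. It governs the
possible lengths of a row between two bounds. -/
def cutSum (P Q : ℕ → A) (lo hi : ℕ) : A :=
  ∑ t ∈ Finset.Icc lo hi, (∏ j ∈ Finset.Ico lo t, P j) * ∏ j ∈ Finset.Ico t hi, Q (j + 1)

theorem cutSum_self (P Q : ℕ → A) (lo : ℕ) : cutSum P Q lo lo = 1 := by
  simp [cutSum]

theorem cutSum_succ (P Q : ℕ → A) {lo hi : ℕ} (h : lo ≤ hi) :
    cutSum P Q lo (hi + 1) =
      cutSum P Q lo hi * Q (hi + 1) + ∏ j ∈ Finset.Ico lo (hi + 1), P j := by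
  rw [cutSum, Finset.sum_Icc_succ_top (by omega), Finset.Ico_self, Finset.prod_empty, mul_one,
    cutSum, Finset.sum_mul]
  refine congrArg (· + _) (Finset.sum_congr rfl fun t ht => ?_)
  rw [Finset.prod_Ico_succ_top (Finset.mem_Icc.1 ht).2, mul_assoc]

variable {P Q : ℕ → A} {c : A}

theorem mul_cutSum (hc : ∀ j, Q j = P j + c) {lo hi : ℕ} (h : lo ≤ hi) :
    c * cutSum P Q lo hi =
      (∏ j ∈ Finset.Ico lo (hi + 1), Q j) - ∏ j ∈ Finset.Ico lo (hi + 1), P j := by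
  induction hi, h using Nat.le_induction with
  | base => simp [cutSum_self, hc]
  | succ t ht ih =>
    rw [cutSum_succ P Q ht, Finset.prod_Ico_succ_top (by omega : lo ≤ t + 1) Q,
      Finset.prod_Ico_succ_top (by omega : lo ≤ t + 1) P]
    linear_combination Q (t + 1) * ih - (∏ j ∈ Finset.Ico lo (t + 1), P j) * hc (t + 1)

theorem cutSum_comm (hc : ∀ j, Q j = P j + c) (lo hi : ℕ) :
    cutSum P Q lo hi = cutSum Q P lo hi := by
  rcases lt_or_ge hi lo with h | h
  · simp [cutSum, Finset.Icc_eq_empty_of_lt h]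
  · induction hi, h using Nat.le_induction with
    | base => simp only [cutSum_self]
    | succ t ht ih =>
      rw [cutSum_succ P Q ht, cutSum_succ Q P ht, ← ih]
      linear_combination mul_cutSum hc ht + cutSum P Q lo t * hc (t + 1)

end Intervals

section Rows

variable {A : Type*} [CommRing A]

/-- The product of the factors `x + b_c` over the contents `c` of the boxes of row `i` in the
columns from `p` to `q - 1`. -/
def rowSchur (x : A) (b : ℤ → A) (i p q : ℕ) : A :=
  ∏ j ∈ Finset.Ico p q, (x + b ((j : ℤ) - i))

/-- The product of the factors `1 + y b_c` over the contents `c` of the positions of row `i` in the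
columns from `p` to `q - 1`: the generating series of the labels on their upper edges. -/
def rowEdge (y : A) (b : ℤ → A) (i p q : ℕ) : A :=
  ∏ j ∈ Finset.Ico p q, (1 + y * b ((j : ℤ) - i))

/-- What is left of the sum over the lengths from `lo` to `hi` of a row between the rows `i` and
`i + 1` of two partitions, after the factors which do not depend on this length are taken out. -/
def rowCore (x y : A) (b : ℤ → A) (i lo hi : ℕ) : A :=
  cutSum (fun j => (x + b ((j : ℤ) - (i + 1 : ℕ))) * y)
    (fun j => 1 + y * b ((j : ℤ) - (i + 1 : ℕ))) lo hi

theorem rowSchur_self (x : A) (b : ℤ → A) (i p : ℕ) : rowSchur x b i p p = 1 := by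
  rw [rowSchur, Finset.Ico_self, Finset.prod_empty]

theorem rowEdge_self (y : A) (b : ℤ → A) (i p : ℕ) : rowEdge y b i p p = 1 := by
  rw [rowEdge, Finset.Ico_self, Finset.prod_empty]

/-- Read with `p, q` as the lengths of row `i` and `p', q'` as those of row `i + 1` of two
partitions. -/
theorem sum_row_upper (x y : A) (b : ℤ → A) (i p q p' q' : ℕ) :
    ∑ s ∈ Finset.Icc (max p' q') (min p q),
        rowSchur x b (i + 1) p' s * y ^ (s - q') * rowEdge y b i s q
      = rowSchur x b (i + 1) p' q' * y ^ (p' - q') * rowEdge y b i p q *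
          rowCore x y b i (max p' q') (min p q) := by
  rw [rowCore, cutSum, Finset.mul_sum]
  refine Finset.sum_congr rfl fun s hs => ?_
  obtain ⟨hlo, hhi⟩ := Finset.mem_Icc.1 hs
  have hcut : s - q' = (p' - q') + (s - max p' q') := by omega
  have hQ (j : ℕ) : ((j + 1 : ℕ) : ℤ) - (i + 1 : ℕ) = j - i := by push_cast; ring
  simp only [hQ, ← Finset.prod_mul_pow_card, Nat.card_Ico]
  rw [rowSchur, prod_Ico_of_max_le _ hlo, rowEdge, prod_Ico_of_le_min _ hhi, hcut, pow_add,
    rowSchur, rowEdge]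
  ring

/-- The counterpart of `sum_row_upper` with the roles of boxes and edges exchanged; the sum over
`s` is brought to the same form by `cutSum_comm`. -/
theorem sum_row_lower (x y : A) (b : ℤ → A) (i p q p' q' : ℕ) :
    ∑ s ∈ Finset.Icc (max p' q') (min p q),
        rowSchur x b i s q * y ^ (p - s) * rowEdge y b (i + 1) p' s
      = rowSchur x b i p q * y ^ (p - q) * rowEdge y b (i + 1) p' q' *
          rowCore x y b i (max p' q') (min p q) := by
  rw [rowCore, cutSum_comm (c := 1 - x * y) fun j => by ring, cutSum, Finset.mul_sum]
  refine Finset.sum_congr rfl fun s hs => ?_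
  obtain ⟨hlo, hhi⟩ := Finset.mem_Icc.1 hs
  have hcut : p - s = (p - q) + (min p q - s) := by omega
  have hP (j : ℕ) : ((j + 1 : ℕ) : ℤ) - (i + 1 : ℕ) = j - i := by push_cast; ring
  simp only [hP, ← Finset.prod_mul_pow_card, Nat.card_Ico]
  rw [rowSchur, prod_Ico_of_le_min _ hhi, rowEdge, prod_Ico_of_max_le _ hlo, hcut, pow_add,
    rowSchur, rowEdge]
  ring

end Rows

section FirstRow

variable {σ R : Type*} [CommRing R] {y : MvPowerSeries σ R}

theorem coeffFinite_mul_pow (hy : y.constantCoeff = 0) (f : ℕ → MvPowerSeries σ R) :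
    CoeffFinite fun k => f k * y ^ k :=
  (CoeffFinite.of_order Set.finite_Iic fun k =>
    MvPowerSeries.le_order_pow_of_constantCoeff_eq_zero k hy).mul_left f

variable [TopologicalSpace R] [IsTopologicalRing R] [T2Space R]

theorem hasSum_rowSchur_mul_edgeTail {b : ℤ → MvPowerSeries σ R} (hb : CoeffFinite b)
    (x : MvPowerSeries σ R) (hy : y.constantCoeff = 0) (s : ℕ) :
    HasSum (fun k : ℕ => rowSchur x b 0 s (s + k) * edgeTail y b (s + k + 1) * y ^ k)
      (MvPowerSeries.invOfUnit (1 - x * y) 1 * edgeTail y b s) := by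
  set F := fun k : ℕ => rowSchur x b 0 s (s + k) * edgeTail y b (s + k + 1) * y ^ k
  set G := fun k : ℕ => rowSchur x b 0 s (s + k) * edgeTail y b (s + k) * y ^ k
  have hF : Summable F := (coeffFinite_mul_pow hy _).summable
  have hG : Summable G := (coeffFinite_mul_pow hy _).summable
  have htelescope (k : ℕ) : (1 - x * y) * F k = G k - G (k + 1) := by
    simp only [F, G, rowSchur, ← add_assoc]
    rw [Finset.prod_Ico_succ_top (by omega), edgeTail_eq_mul hb y (s + k)]
    push_cast
    ring_nf
  have hsum : (1 - x * y) * ∑' k, F k = edgeTail y b s := by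
    rw [← hF.tsum_mul_left, tsum_congr htelescope, hG.tsum_sub ((summable_nat_add_iff 1).2 hG),
      hG.tsum_eq_zero_add]
    simp [G, rowSchur_self]
  rw [← hsum, ← mul_assoc, MvPowerSeries.invOfUnit_mul _ _ (by simp [hy]), one_mul]
  exact hF.hasSum

end FirstRow

section Interlacing

open Classical in
/-- The diagrams `kap` such that both `mu / kap` and `eta / kap` are horizontal strips. -/
def interlacing (mu eta : YoungDiagram) : Finset YoungDiagram :=
  {kap ∈ Finset.Iic eta | HStrip kap mu ∧ HStrip kap eta}

variable {mu eta : YoungDiagram}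

theorem mem_interlacing {kap : YoungDiagram} :
    kap ∈ interlacing mu eta ↔ HStrip kap mu ∧ HStrip kap eta := by
  simp only [interlacing, Finset.mem_filter, Finset.mem_Iic, and_iff_right_iff_imp]
  exact fun h => h.2.1

theorem mem_interlacing_iff_rowLen {kap : YoungDiagram} :
    kap ∈ interlacing mu eta ↔
      ∀ i, kap.rowLen i ∈ Finset.Icc (max (mu.rowLen (i + 1)) (eta.rowLen (i + 1)))
        (min (mu.rowLen i) (eta.rowLen i)) := by
  simp only [mem_interlacing, hStrip_iff_rowLen, ← forall_and, Finset.mem_Icc, max_le_iff,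
    le_min_iff]
  exact forall_congr' fun i => by tauto

theorem sum_prod_rowLen_interlacing {A : Type*} [CommRing A] {r : ℕ} (hmu : mu.rowLen r = 0)
    (heta : eta.rowLen r = 0) (g : ℕ → ℕ → A) :
    ∑ kap ∈ interlacing mu eta, ∏ i ∈ Finset.range r, g i (kap.rowLen i)
      = ∏ i ∈ Finset.range r, ∑ s ∈ Finset.Icc (max (mu.rowLen (i + 1)) (eta.rowLen (i + 1)))
          (min (mu.rowLen i) (eta.rowLen i)), g i s := by
  have hmu' (i : ℕ) (hi : r ≤ i) : mu.rowLen i = 0 := rowLen_eq_zero_of_le hmu hi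
  have heta' (i : ℕ) (hi : r ≤ i) : eta.rowLen i = 0 := rowLen_eq_zero_of_le heta hi
  simp only [Finset.prod_range, Finset.prod_univ_sum]
  refine Finset.sum_nbij (fun kap i => kap.rowLen i) ?_ ?_ ?_ fun _ _ => rfl
  · exact fun kap hkap => Fintype.mem_piFinset.2 fun i => mem_interlacing_iff_rowLen.1 hkap i
  · intro kap hkap kap' hkap' h
    refine rowLen_injective (funext fun i => ?_)
    rcases lt_or_ge i r with hi | hi
    · exact congrFun h ⟨i, hi⟩
    · have hzero := Finset.mem_Icc.1 (mem_interlacing_iff_rowLen.1 hkap i)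
      have hzero' := Finset.mem_Icc.1 (mem_interlacing_iff_rowLen.1 hkap' i)
      have := hmu' i hi
      omega
  · intro p hp
    let f : ℕ → ℕ := fun i => if h : i < r then p ⟨i, h⟩ else 0
    have hf (i : ℕ) : f i ∈ Finset.Icc (max (mu.rowLen (i + 1)) (eta.rowLen (i + 1)))
        (min (mu.rowLen i) (eta.rowLen i)) := by
      rcases lt_or_ge i r with hi | hi
      · simpa only [f, dif_pos hi] using Fintype.mem_piFinset.1 hp ⟨i, hi⟩
      · simp [f, dif_neg hi.not_gt, hmu' (i + 1) (by omega), heta' (i + 1) (by omega)]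
    have hanti : Antitone f := antitone_nat_of_succ_le fun i => by
      have := Finset.mem_Icc.1 (hf i)
      have := Finset.mem_Icc.1 (hf (i + 1))
      omega
    obtain ⟨kap, hkap⟩ := exists_rowLen_eq hanti (dif_neg (lt_irrefl r))
    refine ⟨kap, mem_interlacing_iff_rowLen.2 (hkap ▸ hf), funext fun i => ?_⟩
    simp [hkap, f]

theorem exists_addRow {kap : YoungDiagram} {t : ℕ} (ht : kap.rowLen 0 ≤ t) :
    ∃ lam : YoungDiagram, lam.rowLen 0 = t ∧ ∀ i, lam.rowLen (i + 1) = kap.rowLen i := by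
  obtain ⟨r, hr⟩ := exists_rowLen_eq_zero kap
  have hanti : Antitone fun i : ℕ => Nat.casesOn (motive := fun _ => ℕ) i t kap.rowLen := by
    refine antitone_nat_of_succ_le fun i => ?_
    cases i with
    | zero => exact ht
    | succ i => exact kap.rowLen_anti i (i + 1) i.le_succ
  obtain ⟨lam, hlam⟩ := exists_rowLen_eq hanti (r := r + 1) hr
  exact ⟨lam, congrFun hlam 0, fun i => congrFun hlam (i + 1)⟩

theorem exists_removeRow (lam : YoungDiagram) :
    ∃ kap : YoungDiagram, ∀ i, kap.rowLen i = lam.rowLen (i + 1) := by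
  obtain ⟨r, hr⟩ := exists_rowLen_eq_zero lam
  obtain ⟨kap, hkap⟩ := exists_rowLen_eq (f := fun i => lam.rowLen (i + 1))
    (fun i j hij => lam.rowLen_anti _ _ (Nat.succ_le_succ hij))
    (rowLen_eq_zero_of_le hr r.le_succ)
  exact ⟨kap, congrFun hkap⟩

theorem exists_upperDiagram (mu eta : YoungDiagram) (q : ℕ × interlacing mu eta) :
    ∃ lam : YoungDiagram, lam.rowLen 0 = max (mu.rowLen 0) (eta.rowLen 0) + q.1 ∧
      ∀ i, lam.rowLen (i + 1) = q.2.1.rowLen i := by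
  have h := Finset.mem_Icc.1 (mem_interlacing_iff_rowLen.1 q.2.2 0)
  exact exists_addRow (by omega)

/-- The diagram with the rows of `q.2` below a first row which is `q.1` boxes longer than the
longest row of `mu` and `eta`. -/
def upperDiagram (q : ℕ × interlacing mu eta) : YoungDiagram :=
  (exists_upperDiagram mu eta q).choose

theorem rowLen_upperDiagram_zero (q : ℕ × interlacing mu eta) :
    (upperDiagram q).rowLen 0 = max (mu.rowLen 0) (eta.rowLen 0) + q.1 :=
  (exists_upperDiagram mu eta q).choose_spec.1

theorem rowLen_upperDiagram_succ (q : ℕ × interlacing mu eta) (i : ℕ) :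
    (upperDiagram q).rowLen (i + 1) = q.2.1.rowLen i :=
  (exists_upperDiagram mu eta q).choose_spec.2 i

theorem upperDiagram_injective :
    Function.Injective (upperDiagram (mu := mu) (eta := eta)) := by
  intro p q h
  refine Prod.ext ?_ (Subtype.ext (rowLen_injective (funext fun i => ?_)))
  · exact Nat.add_left_cancel (by rw [← rowLen_upperDiagram_zero, h, rowLen_upperDiagram_zero])
  · rw [← rowLen_upperDiagram_succ, h, rowLen_upperDiagram_succ]

theorem hStrip_and_hStrip_iff_rowLen {lam : YoungDiagram} :
    HStrip mu lam ∧ HStrip eta lam ↔ max (mu.rowLen 0) (eta.rowLen 0) ≤ lam.rowLen 0 ∧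
      ∀ i, lam.rowLen (i + 1) ∈ Finset.Icc (max (mu.rowLen (i + 1)) (eta.rowLen (i + 1)))
        (min (mu.rowLen i) (eta.rowLen i)) := by
  simp only [hStrip_iff_rowLen, Finset.mem_Icc, max_le_iff, le_min_iff, forall_and]
  rw [← Nat.and_forall_add_one (p := fun i => mu.rowLen i ≤ lam.rowLen i),
    ← Nat.and_forall_add_one (p := fun i => eta.rowLen i ≤ lam.rowLen i)]
  tauto

theorem range_upperDiagram :
    Set.range (upperDiagram (mu := mu) (eta := eta)) = {lam | HStrip mu lam ∧ HStrip eta lam} := by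
  ext lam
  rw [Set.mem_ofPred_eq, hStrip_and_hStrip_iff_rowLen]
  constructor
  · rintro ⟨q, rfl⟩
    simp only [rowLen_upperDiagram_zero, rowLen_upperDiagram_succ]
    exact ⟨Nat.le_add_right _ _, mem_interlacing_iff_rowLen.1 q.2.2⟩
  · rintro ⟨hzero, hsucc⟩
    obtain ⟨kap, hkap⟩ := exists_removeRow lam
    refine ⟨(lam.rowLen 0 - max (mu.rowLen 0) (eta.rowLen 0), ⟨kap, ?_⟩),
      rowLen_injective (funext fun i => ?_)⟩
    · simpa only [mem_interlacing_iff_rowLen, hkap] using hsucc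
    · cases i with
      | zero => exact (rowLen_upperDiagram_zero _).trans (Nat.add_sub_of_le hzero)
      | succ i => exact (rowLen_upperDiagram_succ _ i).trans (hkap i)

end Interlacing

section Evaluation

variable {mu lam : YoungDiagram} {r : ℕ}

theorem schurStep_eq_prod_rowSchur {A : Type*} [CommRing A] (x : A) (b : ℤ → A)
    (h : HStrip mu lam) (hr : lam.rowLen r = 0) :
    schurStep x b mu lam = ∏ i ∈ Finset.range r, rowSchur x b i (mu.rowLen i) (lam.rowLen i) := by
  rw [schurStep_apply h, prod_sdiff_cells hr]
  rfl

theorem rowEdge_shift {A : Type*} [CommRing A] (y : A) (b : ℤ → A) (i p q : ℕ) :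
    rowEdge y (fun k => b (k + 1)) (i + 1) p q = rowEdge y b i p q := by
  refine Finset.prod_congr rfl fun j _ => ?_
  simp only [Nat.cast_succ, sub_add_eq_sub_sub, sub_add_cancel]

variable {σ R : Type*} [CommRing R] [TopologicalSpace R] [IsTopologicalRing R] [T2Space R]

theorem edgeStep_eq_prod_rowEdge {a : ℤ → MvPowerSeries σ R} (ha : CoeffFinite a)
    (y : MvPowerSeries σ R) (h : HStrip mu lam) {s : ℕ} (hs : lam.rowLen s = 0)
    (hr : mu.rowLen r = 0) :
    edgeStep y a mu lam = (∏ i ∈ Finset.range s, y ^ (lam.rowLen i - mu.rowLen i)) *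
      (edgeTail y a (lam.rowLen 0) *
        ∏ i ∈ Finset.range r, rowEdge y a (i + 1) (lam.rowLen (i + 1)) (mu.rowLen i)) := by
  rw [edgeStep_apply h, ← Finset.prod_const, prod_sdiff_cells hs, tprod_isLabelEdge ha y hr]
  simp [rowEdge]

end Evaluation

section SinglePair

variable {A : Type*} [CommRing A]

/-- The factor of the sums over interlacing diagrams which comes from the boxes that are in just
one of the rows `i` of `mu` and `eta`. -/
def boxFactor (x y : A) (b : ℤ → A) (mu eta : YoungDiagram) (i : ℕ) : A :=
  rowSchur x b i (mu.rowLen i) (eta.rowLen i) * y ^ (mu.rowLen i - eta.rowLen i)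

/-- The factor of the sums over interlacing diagrams which comes from the edges below the row `i`
of `eta` and outside `mu`. -/
def edgeFactor (y : A) (b : ℤ → A) (mu eta : YoungDiagram) (i : ℕ) : A :=
  rowEdge y b i (mu.rowLen i) (eta.rowLen i)

/-- The factor of the sums over interlacing diagrams which comes from the positions between the
rows `i + 1` and `i`. -/
def coreFactor (x y : A) (b : ℤ → A) (mu eta : YoungDiagram) (i : ℕ) : A :=
  rowCore x y b i (max (mu.rowLen (i + 1)) (eta.rowLen (i + 1))) (min (mu.rowLen i) (eta.rowLen i))

theorem sum_interlacing_lower {mu eta : YoungDiagram} {r : ℕ} (hmu : mu.rowLen r = 0)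
    (heta : eta.rowLen r = 0) (x y : A) (b : ℤ → A) :
    ∑ kap ∈ interlacing mu eta, ∏ i ∈ Finset.range r,
        (rowSchur x b i (kap.rowLen i) (eta.rowLen i) * y ^ (mu.rowLen i - kap.rowLen i) *
          rowEdge y b (i + 1) (mu.rowLen (i + 1)) (kap.rowLen i))
      = ∏ i ∈ Finset.range r, (boxFactor x y b mu eta i * edgeFactor y b mu eta (i + 1) *
          coreFactor x y b mu eta i) := by
  rw [sum_prod_rowLen_interlacing hmu heta fun i s => rowSchur x b i s (eta.rowLen i) *
    y ^ (mu.rowLen i - s) * rowEdge y b (i + 1) (mu.rowLen (i + 1)) s]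
  exact Finset.prod_congr rfl fun i _ => sum_row_lower x y b i _ _ _ _

theorem sum_interlacing_upper {mu eta : YoungDiagram} {r : ℕ} (hmu : mu.rowLen r = 0)
    (heta : eta.rowLen r = 0) (x y : A) (b : ℤ → A) :
    ∑ kap ∈ interlacing mu eta, ∏ i ∈ Finset.range r,
        (rowSchur x b (i + 1) (mu.rowLen (i + 1)) (kap.rowLen i) *
          y ^ (kap.rowLen i - eta.rowLen (i + 1)) * rowEdge y b i (kap.rowLen i) (eta.rowLen i))
      = ∏ i ∈ Finset.range r, (boxFactor x y b mu eta (i + 1) * edgeFactor y b mu eta i *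
          coreFactor x y b mu eta i) := by
  rw [sum_prod_rowLen_interlacing hmu heta fun i s => rowSchur x b (i + 1) (mu.rowLen (i + 1)) s *
    y ^ (s - eta.rowLen (i + 1)) * rowEdge y b i s (eta.rowLen i)]
  exact Finset.prod_congr rfl fun i _ => sum_row_upper x y b i _ _ _ _

theorem prod_range_succ_mul_zero {f : ℕ → A} {r : ℕ} (hf : f r = 1) :
    (∏ i ∈ Finset.range r, f (i + 1)) * f 0 = ∏ i ∈ Finset.range r, f i := by
  rw [← Finset.prod_range_succ', Finset.prod_range_succ, hf, mul_one]

variable {σ R : Type*} [CommRing R] [TopologicalSpace R] [IsTopologicalRing R] [T2Space R]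
  {mu eta : YoungDiagram} {r : ℕ} {b : ℤ → MvPowerSeries σ R}

theorem sum_schurStep_mul_edgeStep (hmu : mu.rowLen r = 0) (heta : eta.rowLen r = 0)
    (hb : CoeffFinite b) (x y : MvPowerSeries σ R) :
    ∑ kap ∈ Finset.Iic eta, schurStep x b kap eta * edgeStep y b kap mu
      = edgeTail y b (mu.rowLen 0) * ∏ i ∈ Finset.range r,
          (boxFactor x y b mu eta i * edgeFactor y b mu eta (i + 1) *
            coreFactor x y b mu eta i) := by
  classical
  have hsupport : ∑ kap ∈ interlacing mu eta, schurStep x b kap eta * edgeStep y b kap mu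
      = ∑ kap ∈ Finset.Iic eta, schurStep x b kap eta * edgeStep y b kap mu := by
    refine Finset.sum_subset (Finset.filter_subset _ _) fun kap _ hkap => ?_
    rw [mem_interlacing, not_and_or] at hkap
    rcases hkap with h | h
    · rw [edgeStep_eq_zero h, mul_zero]
    · rw [schurStep_eq_zero h, zero_mul]
  rw [← hsupport, ← sum_interlacing_lower hmu heta, Finset.mul_sum]
  refine Finset.sum_congr rfl fun kap hkap => ?_
  obtain ⟨hkmu, hketa⟩ := mem_interlacing.1 hkap
  have hkap : kap.rowLen r = 0 := Nat.le_zero.1 ((le_iff_rowLen.1 hkmu.1 r).trans hmu.le)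
  rw [schurStep_eq_prod_rowSchur x b hketa heta, edgeStep_eq_prod_rowEdge hb y hkmu hmu hkap]
  simp only [Finset.prod_mul_distrib]
  ring

theorem schurStep_mul_edgeStep_upperDiagram (hmu : mu.rowLen r = 0) (heta : eta.rowLen r = 0)
    (hb : CoeffFinite b) (x y : MvPowerSeries σ R) (q : ℕ × interlacing mu eta) :
    schurStep x b mu (upperDiagram q) * edgeStep y (fun k => b (k + 1)) eta (upperDiagram q)
      = boxFactor x y b mu eta 0 *
        (rowSchur x b 0 (max (mu.rowLen 0) (eta.rowLen 0))
            (max (mu.rowLen 0) (eta.rowLen 0) + q.1) *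
          edgeTail y b ((max (mu.rowLen 0) (eta.rowLen 0) : ℕ) + q.1 + 1) * y ^ q.1) *
        ∏ i ∈ Finset.range r, (rowSchur x b (i + 1) (mu.rowLen (i + 1)) (q.2.1.rowLen i) *
          y ^ (q.2.1.rowLen i - eta.rowLen (i + 1)) *
            rowEdge y b i (q.2.1.rowLen i) (eta.rowLen i)) := by
  have hstrip := (range_upperDiagram (mu := mu) (eta := eta)).le (Set.mem_range_self q)
  rw [Set.mem_ofPred_eq] at hstrip
  have hzero : (upperDiagram q).rowLen (r + 1) = 0 := by
    have := Finset.mem_Icc.1 ((hStrip_and_hStrip_iff_rowLen.1 hstrip).2 r)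
    omega
  have hfirst : rowSchur x b 0 (mu.rowLen 0) (max (mu.rowLen 0) (eta.rowLen 0) + q.1)
      = rowSchur x b 0 (mu.rowLen 0) (eta.rowLen 0) *
        rowSchur x b 0 (max (mu.rowLen 0) (eta.rowLen 0))
          (max (mu.rowLen 0) (eta.rowLen 0) + q.1) :=
    prod_Ico_of_max_le _ (Nat.le_add_right _ _)
  have hpow : max (mu.rowLen 0) (eta.rowLen 0) + q.1 - eta.rowLen 0
      = (mu.rowLen 0 - eta.rowLen 0) + q.1 := by omega
  rw [schurStep_eq_prod_rowSchur x b hstrip.1 hzero,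
    edgeStep_eq_prod_rowEdge (hb.comp_injective (add_left_injective 1)) y hstrip.2 hzero heta,
    Finset.prod_range_succ', Finset.prod_range_succ']
  simp only [rowEdge_shift, edgeTail_shift, rowLen_upperDiagram_succ, rowLen_upperDiagram_zero,
    Finset.prod_mul_distrib, hfirst, hpow, pow_add, boxFactor, Nat.cast_add]
  ring

theorem hasSum_schurStep_mul_edgeStep (hmu : mu.rowLen r = 0) (heta : eta.rowLen r = 0)
    (hb : CoeffFinite b) (x : MvPowerSeries σ R) {y : MvPowerSeries σ R}
    (hy : y.constantCoeff = 0) :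
    HasSum (fun lam => schurStep x b mu lam * edgeStep y (fun k => b (k + 1)) eta lam)
      (boxFactor x y b mu eta 0 * (MvPowerSeries.invOfUnit (1 - x * y) 1 *
          edgeTail y b (max (mu.rowLen 0) (eta.rowLen 0) : ℕ)) *
        ∏ i ∈ Finset.range r, (boxFactor x y b mu eta (i + 1) * edgeFactor y b mu eta i *
          coreFactor x y b mu eta i)) := by
  have hsupport (lam : YoungDiagram)
      (hlam : lam ∉ Set.range (upperDiagram (mu := mu) (eta := eta))) :
      schurStep x b mu lam * edgeStep y (fun k => b (k + 1)) eta lam = 0 := by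
    rw [range_upperDiagram, Set.mem_ofPred_eq, not_and_or] at hlam
    rcases hlam with h | h
    · rw [schurStep_eq_zero h, zero_mul]
    · rw [edgeStep_eq_zero h, mul_zero]
  have hsummable := (((rowFinite_edgeStep hy fun k => b (k + 1)) eta).mul_left
    (schurStep x b mu)).comp_injective (upperDiagram_injective (mu := mu) (eta := eta)) |>.summable
  have hfirst := (hasSum_rowSchur_mul_edgeTail hb x hy (max (mu.rowLen 0) (eta.rowLen 0))).mul_left
    (boxFactor x y b mu eta 0)
  have hrows := (interlacing mu eta).hasSum fun kap => ∏ i ∈ Finset.range r,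
    (rowSchur x b (i + 1) (mu.rowLen (i + 1)) (kap.rowLen i) *
      y ^ (kap.rowLen i - eta.rowLen (i + 1)) * rowEdge y b i (kap.rowLen i) (eta.rowLen i))
  rw [sum_interlacing_upper hmu heta] at hrows
  rw [← upperDiagram_injective.hasSum_iff hsupport]
  simp only [Function.comp_def, schurStep_mul_edgeStep_upperDiagram hmu heta hb] at hsummable ⊢
  exact (hfirst.mul hrows hsummable :)

theorem intertwine_schurStep_edgeStep (hb : CoeffFinite b) (x : MvPowerSeries σ R)
    {y : MvPowerSeries σ R} (hy : y.constantCoeff = 0) :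
    Intertwine (schurStep x b) (edgeStep y fun k => b (k + 1)) (schurStep x b) (edgeStep y b)
      (MvPowerSeries.invOfUnit (1 - x * y) 1) := by
  intro mu eta
  obtain ⟨r₁, hr₁⟩ := exists_rowLen_eq_zero mu
  obtain ⟨r₂, hr₂⟩ := exists_rowLen_eq_zero eta
  have hmu := rowLen_eq_zero_of_le hr₁ (le_max_left r₁ r₂)
  have heta := rowLen_eq_zero_of_le hr₂ (le_max_right r₁ r₂)
  have hbox : boxFactor x y b mu eta (max r₁ r₂) = 1 := by
    simp [boxFactor, hmu, heta, rowSchur_self]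
  have hedge : edgeFactor y b mu eta (max r₁ r₂) = 1 := by
    simp [edgeFactor, hmu, heta, rowEdge_self]
  have htail : edgeTail y b (mu.rowLen 0)
      = edgeFactor y b mu eta 0 * edgeTail y b (max (mu.rowLen 0) (eta.rowLen 0) : ℕ) := by
    rw [edgeTail_eq_prod_Ico_mul hb y (le_max_left (mu.rowLen 0) (eta.rowLen 0)),
      prod_Ico_of_max_le _ le_rfl]
    simp [edgeFactor, rowEdge]
  rw [sum_schurStep_mul_edgeStep hmu heta hb]
  refine Eq.subst (motive := fun s => HasSum _ s) ?_
    (hasSum_schurStep_mul_edgeStep hmu heta hb x hy)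
  simp only [Finset.prod_mul_distrib]
  rw [htail, ← prod_range_succ_mul_zero hbox, ← prod_range_succ_mul_zero hedge]
  ring

end SinglePair

section Tableaux

/-- Semistandard tableaux of shape `lam / mu` with `n` letters, the index set of the sum that
defines `factorialSchur`. -/
abbrev Tableau (n : ℕ) (lam mu : YoungDiagram) : Type :=
  {T : SkewBox lam mu → Fin n // IsSemistandard T}

variable {n : ℕ} {lam mu : YoungDiagram}

theorem mem_skewBox {b : ℕ × ℕ} : b ∈ lam.cells \ mu.cells ↔ b ∈ lam ∧ b ∉ mu := by
  simp only [Finset.mem_sdiff, YoungDiagram.mem_cells]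

namespace Tableau

theorem monotone (T : Tableau n lam mu) : Monotone T.1 := by
  rintro ⟨⟨i, j⟩, hb⟩ ⟨⟨i', j'⟩, hc⟩ ⟨hi, hj⟩
  have hbmu := (mem_skewBox.1 hb).2
  have hcorner : (i, j') ∈ lam.cells \ mu.cells :=
    mem_skewBox.2 ⟨lam.up_left_mem hi le_rfl (mem_skewBox.1 hc).1,
      fun h => hbmu (mu.up_left_mem le_rfl hj h)⟩
  refine (T.2.1 ⟨(i, j), hb⟩ ⟨(i, j'), hcorner⟩ rfl hj).trans ?_
  rcases hi.lt_or_eq with h | rfl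
  · exact (T.2.2 ⟨(i, j'), hcorner⟩ ⟨(i', j'), hc⟩ rfl h).le
  · exact le_rfl

/-- The diagram formed by the boxes of `mu` and the boxes of `lam / mu` whose entry is one of the
`l` smallest letters. -/
def level (T : Tableau n lam mu) (l : ℕ) : YoungDiagram where
  cells := {b ∈ lam.cells | ∀ h : b ∈ lam.cells \ mu.cells, (T.1 ⟨b, h⟩ : ℕ) < l}
  isLowerSet := by
    intro b c hcb hb
    simp only [Finset.coe_filter, YoungDiagram.mem_cells, Set.mem_ofPred_eq] at hb ⊢
    refine ⟨lam.isLowerSet hcb hb.1, fun hc => ?_⟩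
    have hb' : b ∈ lam.cells \ mu.cells :=
      mem_skewBox.2 ⟨hb.1, fun h => (mem_skewBox.1 hc).2 (mu.isLowerSet hcb h)⟩
    exact (Fin.le_def.1 (T.monotone (a := ⟨c, hc⟩) (b := ⟨b, hb'⟩) hcb)).trans_lt (hb.2 hb')

theorem mem_level {T : Tableau n lam mu} {l : ℕ} {b : ℕ × ℕ} :
    b ∈ T.level l ↔ b ∈ lam ∧ ∀ h : b ∈ lam.cells \ mu.cells, (T.1 ⟨b, h⟩ : ℕ) < l :=
  Finset.mem_filter

variable (T : Tableau n lam mu)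

theorem level_last : T.level n = lam :=
  le_antisymm (fun _ hb => (mem_level.1 hb).1) fun _ hb => mem_level.2 ⟨hb, fun _ => Fin.is_lt _⟩

theorem le_level (h : mu ≤ lam) (l : ℕ) : mu ≤ T.level l :=
  fun _ hb => mem_level.2 ⟨h hb, fun h' => absurd hb (mem_skewBox.1 h').2⟩

theorem hStrip_level (l : ℕ) : HStrip (T.level l) (T.level (l + 1)) := by
  simp only [HStrip, mem_level]
  refine ⟨fun b hb => ?_, fun i j hb => ⟨lam.up_left_mem i.le_succ le_rfl hb.1, fun h => ?_⟩⟩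
  · rw [mem_level] at hb ⊢
    exact ⟨hb.1, fun h => (hb.2 h).trans l.lt_succ_self⟩
  · have h' : (i + 1, j) ∈ lam.cells \ mu.cells :=
      mem_skewBox.2 ⟨hb.1, fun h' => (mem_skewBox.1 h).2 (mu.up_left_mem i.le_succ le_rfl h')⟩
    exact (Fin.lt_def.1 (T.2.2 ⟨_, h⟩ ⟨_, h'⟩ rfl i.lt_succ_self)).trans_le
      (Nat.lt_succ_iff.1 (hb.2 h'))

variable {T} in
theorem mem_level_succ_sdiff_level {l : ℕ} {b : ℕ × ℕ} :
    b ∈ (T.level (l + 1)).cells \ (T.level l).cells ↔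
      ∃ h : b ∈ lam.cells \ mu.cells, (T.1 ⟨b, h⟩ : ℕ) = l := by
  rw [mem_skewBox, mem_level, mem_level]
  constructor
  · rintro ⟨⟨hb, hle⟩, hlt⟩
    obtain ⟨h, hge⟩ : ∃ h : b ∈ lam.cells \ mu.cells, l ≤ (T.1 ⟨b, h⟩ : ℕ) := by
      by_contra! h
      exact hlt ⟨hb, h⟩
    exact ⟨h, (Nat.lt_succ_iff.1 (hle h)).antisymm hge⟩
  · rintro ⟨h, rfl⟩
    exact ⟨⟨(mem_skewBox.1 h).1, fun _ => Nat.lt_succ_self _⟩, fun hlt => (hlt.2 h).false⟩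

theorem prod_eq_prod_level {A : Type*} [CommMonoid A] (f : Fin n → ℕ × ℕ → A) :
    ∏ b, f (T.1 b) b.1
      = ∏ i : Fin n, ∏ b ∈ (T.level (i + 1)).cells \ (T.level i).cells, f i b := by
  rw [← Finset.prod_fiberwise Finset.univ T.1]
  refine Finset.prod_congr rfl fun i _ => ?_
  refine Finset.prod_bij (fun b _ => b.1) (fun b hb => ?_) (fun b _ c _ h => Subtype.ext h)
    (fun b hb => ?_) fun b hb => by rw [(Finset.mem_filter.1 hb).2]
  · exact mem_level_succ_sdiff_level.2 ⟨b.2, congrArg Fin.val (Finset.mem_filter.1 hb).2⟩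
  · obtain ⟨h, hi⟩ := mem_level_succ_sdiff_level.1 hb
    exact ⟨⟨b, h⟩, Finset.mem_filter.2 ⟨Finset.mem_univ _, Fin.ext hi⟩, rfl⟩

section Extend

variable {nu : YoungDiagram}

open Classical in
/-- The tableau of shape `lam / mu` which extends `T` by a new largest letter in all the boxes of
the horizontal strip `lam / nu`. -/
def extend (T : Tableau n nu mu) (h : HStrip nu lam) : Tableau (n + 1) lam mu where
  val b := if hb : b.1 ∈ nu then (T.1 ⟨b.1, mem_skewBox.2 ⟨hb, (mem_skewBox.1 b.2).2⟩⟩).castSucc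
    else Fin.last n
  property := by
    refine ⟨fun b c hr hc => ?_, fun b c hc hr => ?_⟩
    · by_cases hcnu : c.1 ∈ nu
      · have hbnu : b.1 ∈ nu := nu.isLowerSet (Prod.mk_le_mk.2 ⟨hr.le, hc⟩) hcnu
        simp only [hcnu, hbnu, dite_true, Fin.castSucc_le_castSucc_iff]
        exact T.2.1 _ _ hr hc
      · simp only [hcnu, dite_false]
        exact Fin.le_last _
    · have hbnu : b.1 ∈ nu :=
        h.2 _ _ (lam.isLowerSet (Prod.mk_le_mk.2 ⟨hr, hc.le⟩) (mem_skewBox.1 c.2).1)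
      by_cases hcnu : c.1 ∈ nu
      · simp only [hcnu, hbnu, dite_true, Fin.castSucc_lt_castSucc_iff]
        exact T.2.2 _ _ hc hr
      · simp only [hcnu, hbnu, dite_true, dite_false]
        exact Fin.castSucc_lt_last _

theorem extend_apply_of_mem (T : Tableau n nu mu) (h : HStrip nu lam) {b : ℕ × ℕ}
    (hb : b ∈ nu.cells \ mu.cells) (hb' : b ∈ lam.cells \ mu.cells) :
    (T.extend h).1 ⟨b, hb'⟩ = (T.1 ⟨b, hb⟩).castSucc :=
  dif_pos (mem_skewBox.1 hb).1

theorem extend_apply_of_notMem (T : Tableau n nu mu) (h : HStrip nu lam) {b : SkewBox lam mu}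
    (hb : b.1 ∉ nu) : (T.extend h).1 b = Fin.last n :=
  dif_neg hb

theorem level_extend (T : Tableau n nu mu) (h : HStrip nu lam) (hmu : mu ≤ nu) {l : ℕ}
    (hl : l ≤ n) : (T.extend h).level l = T.level l := by
  refine SetLike.ext fun b => ?_
  rw [mem_level, mem_level]
  constructor
  · rintro ⟨hb, hlt⟩
    have hbnu : b ∈ nu := by
      by_contra hbnu
      have hlast := hlt (mem_skewBox.2 ⟨hb, fun hbmu => hbnu (hmu hbmu)⟩)
      rw [extend_apply_of_notMem _ _ hbnu, Fin.val_last] at hlast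
      exact hl.not_gt hlast
    refine ⟨hbnu, fun hb' => ?_⟩
    have hlt' := hlt (mem_skewBox.2 ⟨hb, (mem_skewBox.1 hb').2⟩)
    rwa [extend_apply_of_mem T h hb'] at hlt'
  · rintro ⟨hbnu, hlt⟩
    refine ⟨h.1 hbnu, fun hb' => ?_⟩
    have hb : b ∈ nu.cells \ mu.cells := mem_skewBox.2 ⟨hbnu, (mem_skewBox.1 hb').2⟩
    rw [extend_apply_of_mem T h hb]
    exact hlt hb

theorem extend_injective (h : HStrip nu lam) :
    Function.Injective fun T : Tableau n nu mu => T.extend h := by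
  intro T T' heq
  refine Subtype.ext (funext fun b => ?_)
  obtain ⟨hb, hbmu⟩ := mem_skewBox.1 b.2
  have hval := congrFun (congrArg Subtype.val heq) ⟨b.1, mem_skewBox.2 ⟨h.1 hb, hbmu⟩⟩
  dsimp only at hval
  rwa [extend_apply_of_mem T h b.2, extend_apply_of_mem T' h b.2, Fin.castSucc_inj] at hval

theorem hStrip_level_last (T : Tableau (n + 1) lam mu) : HStrip (T.level n) lam := by
  simpa only [level_last] using T.hStrip_level n

theorem exists_extend_eq (T : Tableau (n + 1) lam mu) :
    ∃ T' : Tableau n (T.level n) mu, T'.extend T.hStrip_level_last = T := by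
  have hmem (b : SkewBox (T.level n) mu) : b.1 ∈ lam.cells \ mu.cells :=
    mem_skewBox.2 ⟨T.hStrip_level_last.1 (mem_skewBox.1 b.2).1, (mem_skewBox.1 b.2).2⟩
  have hlt (b : SkewBox (T.level n) mu) : (T.1 ⟨b.1, hmem b⟩ : ℕ) < n :=
    (mem_level.1 (mem_skewBox.1 b.2).1).2 (hmem b)
  refine ⟨⟨fun b => (T.1 ⟨b.1, hmem b⟩).castLT (hlt b), fun b c => T.2.1 ⟨b, hmem b⟩ ⟨c, hmem c⟩,
    fun b c => T.2.2 ⟨b, hmem b⟩ ⟨c, hmem c⟩⟩, Subtype.ext (funext fun b => ?_)⟩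
  by_cases hb : b.1 ∈ T.level n
  · exact extend_apply_of_mem _ _ (mem_skewBox.2 ⟨hb, (mem_skewBox.1 b.2).2⟩) b.2
  · rw [extend_apply_of_notMem _ _ hb]
    refine le_antisymm ?_ (Fin.le_last _)
    by_contra hlast
    exact hb (mem_level.2 ⟨(mem_skewBox.1 b.2).1, fun _ => Fin.lt_def.1 (not_le.1 hlast)⟩)

end Extend

end Tableau

section TransferMatrix

variable {A : Type*} [CommRing A]

open Classical in
theorem sum_tableau_zero (h : mu ≤ lam) :
    ∑ _T : Tableau 0 lam mu, (1 : A) = (1 : IncidenceAlgebra A YoungDiagram) mu lam := by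
  rw [IncidenceAlgebra.one_apply]
  split_ifs with heq
  · subst heq
    have : IsEmpty (SkewBox mu mu) := ⟨fun b => (mem_skewBox.1 b.2).2 (mem_skewBox.1 b.2).1⟩
    have : Unique (Tableau 0 mu mu) :=
      { default := ⟨isEmptyElim, fun b => isEmptyElim b, fun b => isEmptyElim b⟩
        uniq := fun T => Subtype.ext (Subsingleton.elim _ _) }
    simp
  · obtain ⟨b, hb, hbmu⟩ := SetLike.exists_of_lt (lt_of_le_of_ne h heq)
    have : IsEmpty (Tableau 0 lam mu) := ⟨fun T => (T.1 ⟨b, mem_skewBox.2 ⟨hb, hbmu⟩⟩).elim0⟩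
    simp

open Classical in
theorem sum_tableau_succ (h : mu ≤ lam) (f : Tableau (n + 1) lam mu → A) :
    ∑ T, f T = ∑ nu ∈ Finset.Icc mu lam,
      if hs : HStrip nu lam then ∑ T : Tableau n nu mu, f (T.extend hs) else 0 := by
  rw [← Finset.sum_fiberwise_of_maps_to (t := Finset.Icc mu lam) (g := fun T => T.level n)
    fun T _ => Finset.mem_Icc.2 ⟨T.le_level h n, T.hStrip_level_last.1⟩]
  refine Finset.sum_congr rfl fun nu hnu => ?_
  split_ifs with hs
  · have hlevel (T : Tableau n nu mu) : (T.extend hs).level n = nu := by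
      rw [T.level_extend hs (Finset.mem_Icc.1 hnu).1 le_rfl, T.level_last]
    refine (Finset.sum_nbij (fun T : Tableau n nu mu => T.extend hs)
      (fun T _ => ?_) (Tableau.extend_injective hs).injOn (fun T hT => ?_) fun _ _ => rfl).symm
    · exact Finset.mem_filter.2 ⟨Finset.mem_univ _, hlevel T⟩
    · obtain rfl := (Finset.mem_filter.1 hT).2
      obtain ⟨T', hT'⟩ := T.exists_extend_eq
      exact ⟨T', Finset.mem_coe.2 (Finset.mem_univ _), hT'⟩
  · refine Finset.sum_eq_zero fun T hT => absurd ?_ hs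
    exact (Finset.mem_filter.1 hT).2 ▸ T.hStrip_level_last

open Classical in
theorem sum_prod_level (W : Fin n → IncidenceAlgebra A YoungDiagram)
    (hW : ∀ i nu lam, ¬HStrip nu lam → W i nu lam = 0) (h : mu ≤ lam) :
    ∑ T : Tableau n lam mu, ∏ i : Fin n, W i (T.level i) (T.level (i + 1))
      = (List.ofFn W).prod mu lam := by
  induction n generalizing lam with
  | zero => simpa using sum_tableau_zero h
  | succ n ih =>
    rw [List.ofFn_succ', List.concat_eq_append, List.prod_append, List.prod_singleton,
      IncidenceAlgebra.mul_apply, sum_tableau_succ h]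
    refine Finset.sum_congr rfl fun nu hnu => ?_
    have hmu := (Finset.mem_Icc.1 hnu).1
    split_ifs with hs
    · rw [← ih (fun i => W i.castSucc) (fun i => hW i.castSucc) hmu, Finset.sum_mul]
      refine Finset.sum_congr rfl fun T _ => ?_
      rw [Fin.prod_univ_castSucc, Fin.val_last, Tableau.level_last, T.level_extend hs hmu le_rfl,
        T.level_last]
      refine congrArg (· * W (Fin.last n) nu lam) (Finset.prod_congr rfl fun i _ => ?_)
      rw [Fin.val_castSucc, T.level_extend hs hmu i.is_lt.le, T.level_extend hs hmu i.is_lt]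
    · rw [hW _ _ _ hs, mul_zero]

theorem factorialSchur_neg_eq (lam mu : YoungDiagram) (x : Fin n → A) (a : ℤ → A) :
    factorialSchur lam mu x (-a)
      = (List.ofFn fun i : Fin n => schurStep (x i) (shift i a)).prod mu lam := by
  rw [factorialSchur]
  split_ifs with h
  · rw [← sum_prod_level _ (fun i _ _ hs => schurStep_eq_zero hs _ _) h]
    refine Finset.sum_congr rfl fun T _ => ?_
    rw [Tableau.prod_eq_prod_level T fun i b => x i - (-a) ((i : ℕ) + 1 + content b)]
    refine Finset.prod_congr rfl fun i _ => ?_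
    rw [schurStep_apply (Tableau.hStrip_level T i)]
    refine Finset.prod_congr rfl fun b _ => ?_
    rw [Pi.neg_apply, sub_neg_eq_add, shift, add_comm (content b + _), add_comm (content b),
      add_left_comm, ← add_assoc]
  · rw [IncidenceAlgebra.apply_eq_zero_of_not_le h]

end TransferMatrix

end Tableaux

section EdgeTableaux

variable {m : ℕ} {lam mu : YoungDiagram}

namespace Tableau

variable (T : Tableau m lam mu)

theorem notMem_level_succ_iff (h : mu ≤ lam) {e : ℕ × ℕ} {l : Fin m} :
    e ∉ T.level (l + 1) ↔ e ∉ mu ∧ ∀ b : SkewBox lam mu, b.1 = e → l < T.1 b := by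
  constructor
  · refine fun he => ⟨fun hmu => he (T.le_level h _ hmu), ?_⟩
    rintro ⟨b, hb⟩ rfl
    by_contra hl
    exact he (mem_level.2 ⟨(mem_skewBox.1 hb).1, fun _ => Nat.lt_succ_of_le (not_lt.1 hl)⟩)
  · rintro ⟨hmu, hl⟩ he
    obtain ⟨hlam, hlt⟩ := mem_level.1 he
    have hb := mem_skewBox.2 ⟨hlam, hmu⟩
    exact (Nat.lt_succ_iff.1 (hlt hb)).not_gt (hl ⟨e, hb⟩ rfl)

theorem forall_above_mem_level_iff {e : ℕ × ℕ} {l : Fin m} :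
    (∀ i < e.1, (i, e.2) ∈ T.level l) ↔ (∀ i < e.1, (i, e.2) ∈ lam) ∧
      ∀ b : SkewBox lam mu, (b.1.1 + 1, b.1.2) = e → T.1 b < l := by
  constructor
  · refine fun habove => ⟨fun i hi => (mem_level.1 (habove i hi)).1, ?_⟩
    rintro ⟨b, hb⟩ rfl
    exact (mem_level.1 (habove b.1 b.1.lt_succ_self)).2 hb
  · rintro ⟨hlam, hl⟩ i hi
    obtain ⟨k, j⟩ := e
    obtain ⟨k, rfl⟩ := Nat.exists_eq_succ_of_ne_zero (Nat.ne_zero_of_lt hi)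
    have hik : i ≤ k := Nat.lt_succ_iff.1 hi
    refine mem_level.2 ⟨hlam i hi, fun hb => ?_⟩
    have hk : (k, j) ∈ lam.cells \ mu.cells :=
      mem_skewBox.2 ⟨hlam k k.lt_succ_self, fun hmu =>
        (mem_skewBox.1 hb).2 (mu.up_left_mem hik le_rfl hmu)⟩
    exact (T.monotone (Prod.mk_le_mk.2 ⟨hik, le_rfl⟩) : T.1 ⟨(i, j), hb⟩ ≤ _).trans_lt
      (hl ⟨(k, j), hk⟩ rfl)

/-- The pairs of an edge and a label that may be added to the tableau `T`: the edge is one that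
may carry labels in the step of `T` at which the letter of the label is inserted. -/
def admissibleLabels : Set ((ℕ × ℕ) × Fin m) :=
  {p | IsLabelEdge (T.level p.2) (T.level (p.2 + 1)) p.1}

theorem mem_admissibleLabels_iff (h : mu ≤ lam) {p : (ℕ × ℕ) × Fin m} :
    p ∈ T.admissibleLabels ↔ IsLabelEdge lam mu p.1 ∧
      (∀ b : SkewBox lam mu, b.1 = p.1 → p.2 < T.1 b) ∧
        ∀ b : SkewBox lam mu, (b.1.1 + 1, b.1.2) = p.1 → T.1 b < p.2 := by
  rw [admissibleLabels, Set.mem_ofPred_eq, IsLabelEdge, IsLabelEdge, T.notMem_level_succ_iff h,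
    T.forall_above_mem_level_iff, and_and_and_comm]

/-- The admissible labels sorted by their letters. -/
def admissibleLabelsEquiv :
    (Σ l : Fin m, {e : ℕ × ℕ | IsLabelEdge (T.level l) (T.level (l + 1)) e}) ≃
      T.admissibleLabels where
  toFun q := ⟨(q.2.1, q.1), q.2.2⟩
  invFun p := ⟨p.1.2, p.1.1, p.2⟩

end Tableau

namespace EdgeTableau

/-- The semistandard tableau that remains when the edge labels are forgotten. -/
def toTableau (T : EdgeTableau m lam mu) : Tableau m lam mu :=
  ⟨T.entry, T.semistandard⟩

theorem ext_entry_labels {S T : EdgeTableau m lam mu} (h : S.entry = T.entry)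
    (h' : S.labels = T.labels) : S = T := by
  cases S
  cases T
  congr

theorem mem_admissibleLabels (T : EdgeTableau m lam mu) (h : mu ≤ lam) {p : (ℕ × ℕ) × Fin m}
    (hp : p ∈ T.labels) : p ∈ T.toTableau.admissibleLabels :=
  (T.toTableau.mem_admissibleLabels_iff h).2 ⟨T.isLabelEdge p hp, T.label_lt p hp, T.lt_label p hp⟩

/-- The edge labeled tableau obtained by adding a finite set of admissible labels to `T`. -/
def addLabels (h : mu ≤ lam) (T : Tableau m lam mu) (L : Finset T.admissibleLabels) :
    EdgeTableau m lam mu :=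
  have hL p (hp : p ∈ L.map (Function.Embedding.subtype _)) :=
    (T.mem_admissibleLabels_iff h).1 (Finset.property_of_mem_map_subtype L hp)
  { entry := T.1
    labels := L.map (Function.Embedding.subtype _)
    semistandard := T.2
    isLabelEdge := fun p hp => (hL p hp).1
    label_lt := fun p hp => (hL p hp).2.1
    lt_label := fun p hp => (hL p hp).2.2 }

open Classical in
/-- An edge labeled tableau is a semistandard tableau with a finite set of admissible labels. -/
def equivSigmaAdmissibleLabels (h : mu ≤ lam) :
    (Σ T : Tableau m lam mu, Finset T.admissibleLabels) ≃ EdgeTableau m lam mu where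
  toFun q := addLabels h q.1 q.2
  invFun T := ⟨T.toTableau, T.labels.subtype (· ∈ T.toTableau.admissibleLabels)⟩
  left_inv _ := Sigma.ext rfl <| heq_of_eq <| Finset.ext fun _ =>
    Finset.mem_subtype.trans (Finset.mem_map' _)
  right_inv T := ext_entry_labels rfl <|
    (Finset.subtype_map _).trans (Finset.filter_true_of_mem fun _ => T.mem_admissibleLabels h)

theorem weight_addLabels {A : Type*} [CommRing A] (h : mu ≤ lam) (T : Tableau m lam mu)
    (L : Finset T.admissibleLabels) (y : Fin m → A) (a : ℤ → A) :
    (addLabels h T L).weight y a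
      = (∏ b, y (T.1 b)) * ∏ p ∈ L, y p.1.2 * a (content p.1.1) :=
  congrArg ((∏ b, y (T.1 b)) * ·) (Finset.prod_map L (Function.Embedding.subtype _) _)

end EdgeTableau

theorem finite_setOf_isLabelEdge_content_mem (lam mu : YoungDiagram) {F : Set ℤ}
    (hF : F.Finite) : {e : ℕ × ℕ | IsLabelEdge lam mu e ∧ content e ∈ F}.Finite := by
  refine Set.Finite.of_finite_image (f := fun e => (e.1, content e))
    (((Set.finite_Iic lam.card).prod hF).subset ?_) ?_
  · rintro _ ⟨⟨i, j⟩, ⟨he, hc⟩, rfl⟩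
    refine ⟨?_, hc⟩
    rcases i with _ | i
    · exact Nat.zero_le _
    · exact Finset.mem_range.1 (Finset.mem_product.1 (mem_range_card_of_mem
        (he.2 i i.lt_succ_self))).1
  · rintro ⟨i, j⟩ _ ⟨i', j'⟩ _ h
    simp only [Prod.mk.injEq, content] at h ⊢
    omega

section EdgeSchur

variable {σ R : Type*} [CommRing R] {a : ℤ → MvPowerSeries σ R}

theorem coeffFinite_labelWeight (ha : CoeffFinite a) (y : Fin m → MvPowerSeries σ R)
    (lam mu : YoungDiagram) :
    CoeffFinite fun p : {p : (ℕ × ℕ) × Fin m | IsLabelEdge lam mu p.1} =>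
      y p.1.2 * a (content p.1.1) := by
  suffices CoeffFinite fun p : {p : (ℕ × ℕ) × Fin m | IsLabelEdge lam mu p.1} =>
    a (content p.1.1) from this.mul_left fun p => y p.1.2
  intro d
  refine Set.Finite.of_finite_image (f := Subtype.val)
    (((finite_setOf_isLabelEdge_content_mem lam mu (ha d)).prod Set.finite_univ).subset ?_)
    Subtype.val_injective.injOn
  rintro _ ⟨p, hp, rfl⟩
  exact ⟨⟨p.2, hp⟩, Set.mem_univ _⟩

open Classical in
theorem EdgeTableau.coeffFinite_weight (ha : CoeffFinite a) (y : Fin m → MvPowerSeries σ R)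
    (lam mu : YoungDiagram) : CoeffFinite fun T : EdgeTableau m lam mu => T.weight y a := by
  let labelEdges : Set ((ℕ × ℕ) × Fin m) := {p | IsLabelEdge lam mu p.1}
  have hlabels (T : EdgeTableau m lam mu) :
      (T.labels.subtype (· ∈ labelEdges)).map (Function.Embedding.subtype _) = T.labels :=
    (Finset.subtype_map _).trans (Finset.filter_true_of_mem T.isLabelEdge)
  have hinj : Function.Injective fun T : EdgeTableau m lam mu =>
      (T.labels.subtype (· ∈ labelEdges), T.entry) := fun S T hST => by
    obtain ⟨hL, hentry⟩ := Prod.mk.inj hST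
    exact ext_entry_labels hentry (by rw [← hlabels S, ← hlabels T, hL])
  have hfin := (coeffFinite_labelWeight ha y lam mu).finset_prod.prod_mul
    (g := fun _ (T : SkewBox lam mu → Fin m) => ∏ b, y (T b)) fun _ _ => Set.toFinite _
  refine (funext fun T => ?_ : (fun T : EdgeTableau m lam mu => T.weight y a) = _) ▸
    hfin.comp_injective hinj
  rw [weight, mul_comm]
  conv_lhs => rw [← hlabels T, Finset.prod_map]
  rfl

theorem Tableau.coeffFinite_admissibleLabels (ha : CoeffFinite a) (y : Fin m → MvPowerSeries σ R)
    (T : Tableau m lam mu) (h : mu ≤ lam) :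
    CoeffFinite fun p : T.admissibleLabels => y p.1.2 * a (content p.1.1) :=
  have hsub : T.admissibleLabels ⊆ {p | IsLabelEdge lam mu p.1} :=
    fun _ hp => ((T.mem_admissibleLabels_iff h).1 hp).1
  ((coeffFinite_labelWeight ha y lam mu).comp_injective (Set.inclusion_injective hsub) :)

variable [TopologicalSpace R] [IsTopologicalRing R] [T2Space R]

theorem Tableau.tprod_admissibleLabels (ha : CoeffFinite a) (y : Fin m → MvPowerSeries σ R)
    (T : Tableau m lam mu) (h : mu ≤ lam) :
    ∏' p : T.admissibleLabels, (1 + y p.1.2 * a (content p.1.1))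
      = ∏ l : Fin m, ∏' e : {e : ℕ × ℕ | IsLabelEdge (T.level l) (T.level (l + 1)) e},
          (1 + y l * a (content e)) := by
  have hfin := (T.coeffFinite_admissibleLabels ha y h).comp_injective
    T.admissibleLabelsEquiv.injective
  rw [← T.admissibleLabelsEquiv.tprod_eq,
    Multipliable.tprod_sigma' (fun l => ?_) hfin.multipliable_one_add, tprod_fintype]
  · rfl
  · exact (hfin.comp_injective sigma_mk_injective).multipliable_one_add

theorem Tableau.tsum_weight_addLabels (ha : CoeffFinite a) (y : Fin m → MvPowerSeries σ R)
    (T : Tableau m lam mu) (h : mu ≤ lam) :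
    ∑' L : Finset T.admissibleLabels, (EdgeTableau.addLabels h T L).weight y a
      = ∏ l : Fin m, edgeStep (y l) a (T.level l) (T.level (l + 1)) := by
  have hsum := (T.coeffFinite_admissibleLabels ha y h).finset_prod.summable
  simp only [EdgeTableau.weight_addLabels]
  rw [hsum.tsum_mul_left, ← tprod_one_add hsum, T.tprod_admissibleLabels ha y h,
    T.prod_eq_prod_level fun l _ => y l, ← Finset.prod_mul_distrib]
  refine Finset.prod_congr rfl fun l _ => ?_
  rw [edgeStep_apply (T.hStrip_level l), Finset.prod_const]

open Classical in
theorem edgeSchur_eq (ha : CoeffFinite a) (y : Fin m → MvPowerSeries σ R)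
    (lam mu : YoungDiagram) :
    edgeSchur lam mu y a = (List.ofFn fun j : Fin m => edgeStep (y j) a).prod mu lam := by
  rw [edgeSchur]
  split_ifs with h
  · have hfin : CoeffFinite fun q : Σ T : Tableau m lam mu, Finset T.admissibleLabels =>
        (EdgeTableau.addLabels h q.1 q.2).weight y a :=
      (EdgeTableau.coeffFinite_weight ha y lam mu).comp_injective
        (EdgeTableau.equivSigmaAdmissibleLabels h).injective
    calc ∑' T : EdgeTableau m lam mu, T.weight y a
      _ = ∑' q : Σ T : Tableau m lam mu, Finset T.admissibleLabels,
            (EdgeTableau.addLabels h q.1 q.2).weight y a :=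
          ((EdgeTableau.equivSigmaAdmissibleLabels h).tsum_eq _).symm
      _ = ∑ T : Tableau m lam mu, ∑' L, (EdgeTableau.addLabels h T L).weight y a :=
          hfin.tsum_sigma.trans (tsum_fintype _)
      _ = ∑ T : Tableau m lam mu, ∏ j : Fin m, edgeStep (y j) a (T.level j) (T.level (j + 1)) :=
          Finset.sum_congr rfl fun T _ => T.tsum_weight_addLabels ha y h
      _ = _ := sum_prod_level _ (fun j _ _ hs => edgeStep_eq_zero hs _ _) h
  · rw [IncidenceAlgebra.apply_eq_zero_of_not_le h]

end EdgeSchur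

end EdgeTableaux

section Main

theorem coeffFinite_X {σ R : Type*} [CommRing R] :
    CoeffFinite (MvPowerSeries.X : σ → MvPowerSeries σ R) := by
  classical
  refine fun d => d.support.finite_toSet.subset fun s hs => ?_
  obtain rfl : d = Finsupp.single s 1 := by
    by_contra hd
    exact hs (by rw [MvPowerSeries.coeff_X, if_neg hd])
  simp

theorem coeffFinite_paramA (n m : ℕ) (R : Type*) [CommRing R] (N : WithTop ℤ) :
    CoeffFinite (paramA n m R N) := by
  classical
  have hX := coeffFinite_X (R := R).comp_injective
    (Sum.inr_injective.comp Sum.inr_injective : Function.Injective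
      fun k : ℤ => (Sum.inr (Sum.inr k) : Fin n ⊕ Fin m ⊕ ℤ))
  convert hX.mul_left fun k => if (k : WithTop ℤ) ≤ N then 1 else 0 using 2 with k
  rw [paramA, ite_mul, one_mul, zero_mul, Function.comp_apply]

theorem CoeffFinite.shift {σ R : Type*} [CommRing R] {a : ℤ → MvPowerSeries σ R}
    (ha : CoeffFinite a) (k : ℕ) : CoeffFinite (shift k a) :=
  ha.comp_injective fun i j h => by simpa using h

theorem shift_succ {A : Type*} (k : ℕ) (a : ℤ → A) :
    shift (k + 1) a = fun i => shift k a (i + 1) := by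
  funext i
  simp only [SkewCauchy.shift, Nat.cast_succ, add_left_comm, add_comm]

theorem hasSum_factorialSchur_mul {A : Type*} [CommRing A] [TopologicalSpace A] {n : ℕ}
    (lam : YoungDiagram) (x : Fin n → A) (a : ℤ → A) (f : YoungDiagram → A) :
    HasSum (fun mu => factorialSchur lam mu x a * f mu)
      (∑ mu ∈ Finset.Iic lam, factorialSchur lam mu x a * f mu) :=
  hasSum_sum_of_ne_finset_zero fun mu hmu => by
    rw [factorialSchur, if_neg (mt Finset.mem_Iic.2 hmu), zero_mul]

variable {σ R : Type*} [CommRing R] [TopologicalSpace R] [IsTopologicalRing R] [T2Space R]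
  {n m : ℕ} {a : ℤ → MvPowerSeries σ R} {y : Fin m → MvPowerSeries σ R}

theorem intertwine_prod_schurStep_prod_edgeStep (ha : CoeffFinite a)
    (x : Fin n → MvPowerSeries σ R) (hy : ∀ j, (y j).constantCoeff = 0) :
    Intertwine (List.ofFn fun i : Fin n => schurStep (x i) (shift i a)).prod
      (List.ofFn fun j => edgeStep (y j) (shift n a)).prod
      (List.ofFn fun i : Fin n => schurStep (x i) (shift i a)).prod
      (List.ofFn fun j => edgeStep (y j) (shift 0 a)).prod
      (∏ i, ∏ j, MvPowerSeries.invOfUnit (1 - x i * y j) 1) := by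
  rw [Finset.prod_comm]
  refine Intertwine.symm (Intertwine.list_prod (U := fun j => edgeStep (y j) (shift n a))
    (V := fun _ => (List.ofFn fun i : Fin n => schurStep (x i) (shift i a)).prod)
    (.inl fun j => rowFinite_edgeStep (hy j) _) fun j => Intertwine.symm ?_)
  refine Intertwine.list_prod (V := fun k => edgeStep (y j) (shift k a))
    (.inr fun _ => rowFinite_edgeStep (hy j) _) fun i => ?_
  rw [shift_succ]
  exact intertwine_schurStep_edgeStep (ha.shift i) (x i) (hy j)

theorem hasSum_factorialSchur_mul_edgeSchur (ha : CoeffFinite a) (x : Fin n → MvPowerSeries σ R)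
    (hy : ∀ j, (y j).constantCoeff = 0) (mu eta : YoungDiagram) :
    HasSum (fun lam => factorialSchur lam mu x (-a) * edgeSchur lam eta y (shift n a))
      ((∏ i, ∏ j, MvPowerSeries.invOfUnit (1 - x i * y j) 1) * ∑ kap ∈ Finset.Iic eta,
        factorialSchur eta kap x (-a) * edgeSchur mu kap y (shift 0 a)) := by
  simp only [factorialSchur_neg_eq, edgeSchur_eq (ha.shift _)]
  exact intertwine_prod_schurStep_prod_edgeStep ha x hy mu eta

end Main

end SkewCauchy

end

open SkewCauchy in
theorem mainTheorem2_general {σ R : Type*} [CommRing R] [TopologicalSpace R]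
    [IsTopologicalRing R] [T2Space R] {n m : ℕ} (x : Fin n → MvPowerSeries σ R)
    {y : Fin m → MvPowerSeries σ R} (hy : ∀ j, (y j).constantCoeff = 0)
    {a : ℤ → MvPowerSeries σ R} (ha : CoeffFinite a) (mu eta : YoungDiagram) :
    (∀ (k : ℕ) (lam nu : YoungDiagram),
      Summable fun T : EdgeTableau m lam nu => T.weight y (shift k a)) ∧
    (Summable fun lam => factorialSchur lam mu x (-a) * edgeSchur lam eta y (shift n a)) ∧
    (Summable fun kap => factorialSchur eta kap x (-a) * edgeSchur mu kap y (shift 0 a)) ∧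
    ∑' lam, factorialSchur lam mu x (-a) * edgeSchur lam eta y (shift n a) =
      (∏ i, ∏ j, MvPowerSeries.invOfUnit (1 - x i * y j) 1) *
        ∑' kap, factorialSchur eta kap x (-a) * edgeSchur mu kap y (shift 0 a) := by
  have hupper := hasSum_factorialSchur_mul_edgeSchur ha x hy mu eta
  have hlower := hasSum_factorialSchur_mul eta x (-a) fun kap => edgeSchur mu kap y (shift 0 a)
  refine ⟨fun k lam nu => (EdgeTableau.coeffFinite_weight (ha.shift k) y lam nu).summable,
    hupper.summable, hlower.summable, ?_⟩
  rw [hupper.tsum_eq, hlower.tsum_eq]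

/-- The skew Cauchy identity for factorial Schur polynomials and edge Schur functions.
The first conjunct says that the series defining the edge Schur functions converge, the next
two that the two sums of the identity converge. The coefficient ring is discrete. -/
theorem mainTheorem2 (R : Type*) [CommRing R] [TopologicalSpace R] [DiscreteTopology R]
    (n m : ℕ) (N : WithTop ℤ) (mu eta : YoungDiagram) :
    (∀ (k : ℕ) (lam nu : YoungDiagram), Summable fun T : SkewCauchy.EdgeTableau m lam nu =>
      T.weight (SkewCauchy.varY n m R) (SkewCauchy.shift k (SkewCauchy.paramA n m R N))) ∧
    (Summable fun lam : YoungDiagram =>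
      SkewCauchy.factorialSchur lam mu (SkewCauchy.varX n m R) (-SkewCauchy.paramA n m R N) *
        SkewCauchy.edgeSchur lam eta (SkewCauchy.varY n m R)
          (SkewCauchy.shift n (SkewCauchy.paramA n m R N))) ∧
    (Summable fun kap : YoungDiagram =>
      SkewCauchy.factorialSchur eta kap (SkewCauchy.varX n m R) (-SkewCauchy.paramA n m R N) *
        SkewCauchy.edgeSchur mu kap (SkewCauchy.varY n m R)
          (SkewCauchy.shift 0 (SkewCauchy.paramA n m R N))) ∧
    ∑' lam : YoungDiagram,
      SkewCauchy.factorialSchur lam mu (SkewCauchy.varX n m R) (-SkewCauchy.paramA n m R N) *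
        SkewCauchy.edgeSchur lam eta (SkewCauchy.varY n m R)
          (SkewCauchy.shift n (SkewCauchy.paramA n m R N)) =
    (∏ i : Fin n, ∏ j : Fin m,
      MvPowerSeries.invOfUnit (1 - SkewCauchy.varX n m R i * SkewCauchy.varY n m R j) 1) *
    ∑' kap : YoungDiagram,
      SkewCauchy.factorialSchur eta kap (SkewCauchy.varX n m R) (-SkewCauchy.paramA n m R N) *
        SkewCauchy.edgeSchur mu kap (SkewCauchy.varY n m R)
          (SkewCauchy.shift 0 (SkewCauchy.paramA n m R N)) :=
  mainTheorem2_general _ (fun _ => MvPowerSeries.constantCoeff_X _)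
    (SkewCauchy.coeffFinite_paramA n m R N) mu eta
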